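/- **Setting.** Let $h_c>0$, $h_d\in\mathbb{Z}_{\ge0}$, $\bar T>0$. Consider the impulsive system with delays $$\dot x(t)=Ax(t)+G_cx(t-h_c)+E_cw_c(t)\ (t\ne t_k),\qquad x(t_k^+)=Jx(t_k)+G_dx(t_{k-h_d})+E_dw_d(k)\ (k\ge1),$$ $$y_c(t)=C_{yc}x(t)+H_{yc}x(t-h_c)+F_{yc}w_c(t),\qquad y_d(k)=C_{yd}x(t_k)+H_{yd}x(t_{k-h_d})+F_{yd}w_d(k),$$ with $x(t)\in\mathbb{R}^n$, real matrices of compatible sizes ($y_c$ and $y_d$ have $r_c$ and $r_d$ entries), a continuous initial function on $[-h_c,0]$, and a prescribed discrete history giving the values written $x(t_j)$ for $-h_d<j<0$. Trajectories are left-continuous at the impulse times and solve the differential equation in the sense of Carathéodory. The impulse times satisfy the minimum dwell-time condition $t_0=0$, $t_{k+1}-t_k\ge\bar T$ for all $k\ge0$, with no jump at $t_0$. For $\bullet\in\{-,+\}$ the observer with gains $\tilde L_c:[0,\bar T]\to\mathbb{R}^{n\times r_c}$ and $L_d\in\mathbb{R}^{n\times r_d}$ is $$\dot x^\bullet(t)=Ax^\bullet(t)+G_cx^\bullet(t-h_c)+E_cw_c^\bullet(t)+L_c(t)\big(y_c(t)-C_{yc}x^\bullet(t)-H_{yc}x^\bullet(t-h_c)-F_{yc}w_c^\bullet(t)\big),$$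 $$x^\bullet(t_k^+)=Jx^\bullet(t_k)+G_dx^\bullet(t_{k-h_d})+E_dw_d^\bullet(k)+L_d\big(y_d(k)-C_{yd}x^\bullet(t_k)-H_{yd}x^\bullet(t_{k-h_d})-F_{yd}w_d^\bullet(k)\big),$$ where, for $t\in(t_k,t_{k+1}]$, $L_c(t)=\tilde L_c(t-t_k)$ if $t-t_k\le\bar T$ and $L_c(t)=\tilde L_c(\bar T)$ otherwise. The errors $e^+=x^+-x$ and $e^-=x-x^-$ both obey the error dynamics $$\dot e(t)=(A-L_c(t)C_{yc})e(t)+(G_c-L_c(t)H_{yc})e(t-h_c)+(E_c-L_c(t)F_{yc})\delta_c(t),$$ $$e(t_k^+)=(J-L_dC_{yd})e(t_k)+(G_d-L_dH_{yd})e(t_{k-h_d})+(E_d-L_dF_{yd})\delta_d(k),$$ with performance outputs $e_c(t)=M_ce(t)$ and $e_d(k)=M_de(t_k)$, where $M_c,M_d\in\mathbb{R}^{n\times n}$ are given entrywise nonnegative matrices, and with $\delta_c^+=w_c^+-w_c$, $\delta_c^-=w_c-w_c^-$, and similarly for $\delta_d^\pm$. **Theorem.** Let $X:[0,\bar T]\to\mathbb{R}^{n\times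 n}$ be differentiable with $X(\tau)$ diagonal and invertible for every $\tau\in[0,\bar T]$, and $X(0)\succ0$. Let $Y_c:[0,\bar T]\to\mathbb{R}^{n\times r_c}$ be a function, $Y_d\in\mathbb{R}^{n\times r_d}$, $U_c\succ0$ a diagonal $n\times n$ matrix, and $\varepsilon,\alpha,\gamma>0$. Write $\mathbf 1$ for vectors of ones. Assume that the following hold entrywise for all $\tau\in[0,\bar T]$: $$X(\tau)A-Y_c(\tau)C_{yc}+\alpha I\ge0,\quad X(\tau)G_c-Y_c(\tau)H_{yc}\ge0,\quad X(\tau)E_c-Y_c(\tau)F_{yc}\ge0,$$ $$X(0)J-Y_dC_{yd}\ge0,\quad X(0)G_d-Y_dH_{yd}\ge0,\quad X(0)E_d-Y_dF_{yd}\ge0,$$ $$\mathbf 1^T[X(\bar T)A-Y_c(\bar T)C_{yc}+U_c]+\mathbf 1^TM_c\le0,$$ $$\mathbf 1^T[X(\bar T)G_c-Y_c(\bar T)H_{yc}-U_c]\le0,\quad \mathbf 1^T[X(\bar T)E_c-Y_c(\bar T)F_{yc}]-\gamma\mathbf 1^T\le0,$$ $$\mathbf 1^T[\dot X(\tau)+X(\tau)A-Y_c(\tau)C_{yc}+U_c]+\mathbf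 1^TM_c\le0,$$ $$\mathbf 1^T[X(\tau)G_c-Y_c(\tau)H_{yc}-U_c]\le0,\quad \mathbf 1^T[X(\tau)E_c-Y_c(\tau)F_{yc}]-\gamma\mathbf 1^T\le0,$$ $$\mathbf 1^T[X(0)(J+G_d)-Y_d(C_{yd}+H_{yd})-X(\bar T)+\varepsilon I]+\mathbf 1^TM_d\le0,\quad \mathbf 1^T[X(0)E_d-Y_dF_{yd}]-\gamma\mathbf 1^T\le0.$$ Then the observer with gains $\tilde L_c(\tau)=X(\tau)^{-1}Y_c(\tau)$ and $L_d=X(0)^{-1}Y_d$ is an interval observer that solves the minimum dwell-time interval observation problem. That is: 0. for all impulse times with minimum dwell-time $\bar T$, if $w_c^-\le w_c\le w_c^+$, $w_d^-\le w_d\le w_d^+$ and the initial data (initial functions and discrete histories) are ordered in the same way, then $x^-(t)\le x(t)\le x^+(t)$ for all $t\ge0$; 1. the error dynamics are state-positive: for all $\tau\in[0,\bar T]$, $A-\tilde L_c(\tau)C_{yc}$ is Metzler and $G_c-\tilde L_c(\tau)H_{yc}$, $E_c-\tilde L_c(\tau)F_{yc}$ are entrywise nonnegative; moreover $J-L_dC_{yd}$,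 $G_d-L_dH_{yd}$ and $E_d-L_dF_{yd}$ are entrywise nonnegative; 2. the error dynamics with zero inputs are asymptotically stable under minimum dwell-time $\bar T$: they are Lyapunov stable, uniformly over the impulse times with minimum dwell-time $\bar T$, and for all such impulse times all trajectories converge to $0$; 3. the map $(\delta_c,\delta_d)\mapsto(e_c,e_d)$ has a hybrid $L_1/\ell_1$-gain of at most $\gamma$: there is an increasing function $v:[0,\infty)\to[0,\infty)$ with $v(0)=0$ and $v(s)\to\infty$ as $s\to\infty$ such that, for all impulse times with minimum dwell-time $\bar T$, all $\delta_c\in L_1$, $\delta_d\in\ell_1$ and all corresponding error trajectories, $$\|e_c\|_{L_1}+\|e_d\|_{\ell_1}\le\gamma\big(\|\delta_c\|_{L_1}+\|\delta_d\|_{\ell_1}\big)+v(\|e_0\|).$$ Here the signal norms use the vector $1$-norm, the $\ell_1$ norms sum over $k\ge1$, and $\|e_0\|$ is the sup norm (in the vector $1$-norm) of the initial function on $[-h_c,0]$ plus the sum of the $1$-norms of the discrete history. -/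

import Mathlib

open MeasureTheory Set Filter Topology
open scoped Matrix ENNReal

namespace IntervalObs

/-- Column vectors of dimension `n`. -/
abbrev Vec (n : ℕ) : Type := Fin n → ℝ

/-- The vector `1`-norm. -/
def oneNorm {n : ℕ} (v : Vec n) : ℝ := ∑ i, |v i|

/-- Entrywise nonnegative matrices. -/
def Nonneg {m n : ℕ} (M : Matrix (Fin m) (Fin n) ℝ) : Prop := ∀ i j, 0 ≤ M i j

/-- Metzler matrices: the off-diagonal entries are nonnegative. -/
def Metzler {n : ℕ} (M : Matrix (Fin n) (Fin n) ℝ) : Prop := ∀ i j, i ≠ j → 0 ≤ M i j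

/-- The data (matrices and constant delays) of a linear impulsive system with delays, with state
dimension `n`, inputs of dimensions `pc`, `pd` and measured outputs of dimensions `rc`, `rd`. -/
structure System (n pc pd rc rd : ℕ) where
  A : Matrix (Fin n) (Fin n) ℝ
  Gc : Matrix (Fin n) (Fin n) ℝ
  Ec : Matrix (Fin n) (Fin pc) ℝ
  J : Matrix (Fin n) (Fin n) ℝ
  Gd : Matrix (Fin n) (Fin n) ℝ
  Ed : Matrix (Fin n) (Fin pd) ℝ
  Cyc : Matrix (Fin rc) (Fin n) ℝ
  Hyc : Matrix (Fin rc) (Fin n) ℝ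
  Fyc : Matrix (Fin rc) (Fin pc) ℝ
  Cyd : Matrix (Fin rd) (Fin n) ℝ
  Hyd : Matrix (Fin rd) (Fin n) ℝ
  Fyd : Matrix (Fin rd) (Fin pd) ℝ
  /-- the continuous-time delay -/
  hc : ℝ
  hc_pos : 0 < hc
  /-- the discrete-time delay, counted in impulses -/
  hd : ℕ

/-- Impulse times `0 = t 0 < t 1 < t 2 < ⋯` with dwell-times `t (k + 1) - t k` of at least `Tbar`
(no impulse takes place at `t 0`). -/
def IsMinDwell (Tbar : ℝ) (t : ℕ → ℝ) : Prop :=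
  t 0 = 0 ∧ ∀ k, Tbar ≤ t (k + 1) - t k

/-- The delayed impulse-time state `x(t_{k - hd})`. For `k < hd` the index `k - hd` is negative and
the value comes from the prescribed discrete history: `ψ j` is the value with index `-j`. -/
def pastState {n : ℕ} (hd : ℕ) (t : ℕ → ℝ) (x : ℝ → Vec n) (ψ : ℕ → Vec n) (k : ℕ) : Vec n :=
  if hd ≤ k then x (t (k - hd)) else ψ (hd - k)

/-- `x` is continuous on `[-hc, 0]`, solves `x'(s) = f k s` on each `(t k, t (k + 1)]` in the sense
of Carathéodory (integrated form, with locally integrable right-hand side), and jumps to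
`x((t k)⁺) = g k` at the impulse times `t k`, `k ≥ 1`. The trajectory is left-continuous at the
impulse times, and there is no jump at time `0`. -/
structure IsTrajectory {n : ℕ} (hc : ℝ) (t : ℕ → ℝ) (x : ℝ → Vec n) (f : ℕ → ℝ → Vec n)
    (g : ℕ → Vec n) : Prop where
  init : ContinuousOn x (Icc (-hc) 0)
  integrable : ∀ k, IntervalIntegrable (f k) volume (t k) (t (k + 1))
  flow : ∀ k, ∀ s ∈ Ioc (t k) (t (k + 1)),
    x s = (if k = 0 then x 0 else g k) + ∫ r in (t k)..s, f k r

/-- The gain as a function of the timer `τ`: `L τ` up to `Tbar`, then frozen at `L Tbar`. -/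
noncomputable def timerGain {n r : ℕ} (L : ℝ → Matrix (Fin n) (Fin r) ℝ) (Tbar τ : ℝ) :
    Matrix (Fin n) (Fin r) ℝ :=
  if τ ≤ Tbar then L τ else L Tbar

variable {n pc pd rc rd : ℕ}

/-- Trajectories of the impulsive system with inputs `wc`, `wd` and discrete history `ψ`. -/
def IsPlantTrajectory (S : System n pc pd rc rd) (t : ℕ → ℝ) (wc : ℝ → Vec pc) (wd : ℕ → Vec pd)
    (ψ : ℕ → Vec n) (x : ℝ → Vec n) : Prop :=
  IsTrajectory S.hc t x
    (fun _ r => S.A *ᵥ x r + S.Gc *ᵥ x (r - S.hc) + S.Ec *ᵥ wc r)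
    (fun k => S.J *ᵥ x (t k) + S.Gd *ᵥ pastState S.hd t x ψ k + S.Ed *ᵥ wd k)

/-- The continuous-time output `C_yc x(r) + H_yc x(r - hc) + F_yc w_c(r)`. -/
def outputC (S : System n pc pd rc rd) (wc : ℝ → Vec pc) (x : ℝ → Vec n) (r : ℝ) : Vec rc :=
  S.Cyc *ᵥ x r + S.Hyc *ᵥ x (r - S.hc) + S.Fyc *ᵥ wc r

/-- The discrete-time output `C_yd x(t_k) + H_yd x(t_{k - hd}) + F_yd w_d(k)`. -/
def outputD (S : System n pc pd rc rd) (t : ℕ → ℝ) (wd : ℕ → Vec pd) (ψ : ℕ → Vec n)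
    (x : ℝ → Vec n) (k : ℕ) : Vec rd :=
  S.Cyd *ᵥ x (t k) + S.Hyd *ᵥ pastState S.hd t x ψ k + S.Fyd *ᵥ wd k

/-- Trajectories `z` of the observer with gains `L`, `Ld`, fed with the measurements `yc`, `yd` and
the input bounds `wc`, `wd`. -/
def IsObserverTrajectory (S : System n pc pd rc rd) (Tbar : ℝ)
    (L : ℝ → Matrix (Fin n) (Fin rc) ℝ) (Ld : Matrix (Fin n) (Fin rd) ℝ) (t : ℕ → ℝ)
    (yc : ℝ → Vec rc) (yd : ℕ → Vec rd) (wc : ℝ → Vec pc) (wd : ℕ → Vec pd)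
    (ψ : ℕ → Vec n) (z : ℝ → Vec n) : Prop :=
  IsTrajectory S.hc t z
    (fun k r => S.A *ᵥ z r + S.Gc *ᵥ z (r - S.hc) + S.Ec *ᵥ wc r
      + timerGain L Tbar (r - t k) *ᵥ (yc r - outputC S wc z r))
    (fun k => S.J *ᵥ z (t k) + S.Gd *ᵥ pastState S.hd t z ψ k + S.Ed *ᵥ wd k
      + Ld *ᵥ (yd k - outputD S t wd ψ z k))

/-- Trajectories of the error dynamics with inputs `δc`, `δd` and discrete history `ψ`. -/
def IsErrorTrajectory (S : System n pc pd rc rd) (Tbar : ℝ)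
    (L : ℝ → Matrix (Fin n) (Fin rc) ℝ) (Ld : Matrix (Fin n) (Fin rd) ℝ) (t : ℕ → ℝ)
    (δc : ℝ → Vec pc) (δd : ℕ → Vec pd) (ψ : ℕ → Vec n) (e : ℝ → Vec n) : Prop :=
  IsTrajectory S.hc t e
    (fun k r => (S.A - timerGain L Tbar (r - t k) * S.Cyc) *ᵥ e r
      + (S.Gc - timerGain L Tbar (r - t k) * S.Hyc) *ᵥ e (r - S.hc)
      + (S.Ec - timerGain L Tbar (r - t k) * S.Fyc) *ᵥ δc r)
    (fun k => (S.J - Ld * S.Cyd) *ᵥ e (t k)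
      + (S.Gd - Ld * S.Hyd) *ᵥ pastState S.hd t e ψ k
      + (S.Ed - Ld * S.Fyd) *ᵥ δd k)

/-- The size of the initial condition: the sup norm of the functional initial condition on
`[-hc, 0]` plus the size of the discrete history. -/
noncomputable def initialSize (hc : ℝ) (hd : ℕ) (e : ℝ → Vec n) (ψ : ℕ → Vec n) : ℝ :=
  sSup ((fun s => oneNorm (e s)) '' Icc (-hc) 0) + ∑ j ∈ Finset.Ico 1 hd, oneNorm (ψ j)

/-- The `L₁` norm of a signal on `(0, ∞)`. -/
noncomputable def normL1 {m : ℕ} (w : ℝ → Vec m) : ℝ≥0∞ :=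
  ∫⁻ s in Ioi (0 : ℝ), ENNReal.ofReal (oneNorm (w s))

/-- The `ℓ₁` norm of a signal on the impulse indices `1, 2, …`. -/
noncomputable def norml1 {m : ℕ} (w : ℕ → Vec m) : ℝ≥0∞ :=
  ∑' k : ℕ, ENNReal.ofReal (oneNorm (w (k + 1)))

/-- Asymptotic stability of the unforced error dynamics under minimum dwell-time `Tbar`: Lyapunov
stability, and convergence of all the trajectories to zero. -/
def AsympStable (S : System n pc pd rc rd) (Tbar : ℝ)
    (L : ℝ → Matrix (Fin n) (Fin rc) ℝ) (Ld : Matrix (Fin n) (Fin rd) ℝ) : Prop :=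
  (∀ ε > 0, ∃ δ > 0, ∀ t, IsMinDwell Tbar t → ∀ ψ e,
      IsErrorTrajectory S Tbar L Ld t (fun _ => 0) (fun _ => 0) ψ e →
      initialSize S.hc S.hd e ψ < δ → ∀ s, 0 ≤ s → oneNorm (e s) < ε) ∧
  (∀ t, IsMinDwell Tbar t → ∀ ψ e,
      IsErrorTrajectory S Tbar L Ld t (fun _ => 0) (fun _ => 0) ψ e → Tendsto e atTop (𝓝 0))

/-- The map from `(δc, δd)` to `(Mc e, Md e(t_k))` has a hybrid `L₁/ℓ₁`-gain of at most `γ` under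
minimum dwell-time `Tbar`. -/
def HasHybridGain (S : System n pc pd rc rd) (Mc Md : Matrix (Fin n) (Fin n) ℝ) (Tbar γ : ℝ)
    (L : ℝ → Matrix (Fin n) (Fin rc) ℝ) (Ld : Matrix (Fin n) (Fin rd) ℝ) : Prop :=
  ∃ v : ℝ → ℝ, StrictMonoOn v (Ici 0) ∧ v 0 = 0 ∧ Tendsto v atTop atTop ∧
    ∀ t, IsMinDwell Tbar t → ∀ δc δd, IntegrableOn δc (Ioi 0) →
      Summable (fun k => oneNorm (δd (k + 1))) →
      ∀ ψ e, IsErrorTrajectory S Tbar L Ld t δc δd ψ e →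
        normL1 (fun s => Mc *ᵥ e s) + norml1 (fun k => Md *ᵥ e (t k)) ≤
          ENNReal.ofReal γ * (normL1 δc + norml1 δd)
            + ENNReal.ofReal (v (initialSize S.hc S.hd e ψ))

/-- The two observers enclose the state: `z⁻ ≤ x ≤ z⁺` for all times as soon as the initial data
and the inputs are ordered in this way. -/
def Encloses (S : System n pc pd rc rd) (Tbar : ℝ)
    (L : ℝ → Matrix (Fin n) (Fin rc) ℝ) (Ld : Matrix (Fin n) (Fin rd) ℝ) : Prop :=
  ∀ t, IsMinDwell Tbar t →
    ∀ (wcl wc wcu : ℝ → Vec pc) (wdl wd wdu : ℕ → Vec pd) (ψl ψ ψu : ℕ → Vec n)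
      (zl x zu : ℝ → Vec n),
      (∀ s, 0 ≤ s → wcl s ≤ wc s ∧ wc s ≤ wcu s) →
      (∀ k, wdl k ≤ wd k ∧ wd k ≤ wdu k) →
      (∀ j, ψl j ≤ ψ j ∧ ψ j ≤ ψu j) →
      (∀ s ∈ Icc (-S.hc) 0, zl s ≤ x s ∧ x s ≤ zu s) →
      IsPlantTrajectory S t wc wd ψ x →
      IsObserverTrajectory S Tbar L Ld t (outputC S wc x) (outputD S t wd ψ x) wcl wdl ψl zl →
      IsObserverTrajectory S Tbar L Ld t (outputC S wc x) (outputD S t wd ψ x) wcu wdu ψu zu →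
      ∀ s, 0 ≤ s → zl s ≤ x s ∧ x s ≤ zu s

/-- The gains `L`, `Ld` solve the interval observation problem under minimum dwell-time `Tbar`:
the observers enclose the state, and the error dynamics are state-positive, asymptotically stable,
and have a hybrid `L₁/ℓ₁`-gain of at most `γ`. -/
structure SolvesMinDwell (S : System n pc pd rc rd) (Mc Md : Matrix (Fin n) (Fin n) ℝ)
    (Tbar γ : ℝ) (L : ℝ → Matrix (Fin n) (Fin rc) ℝ) (Ld : Matrix (Fin n) (Fin rd) ℝ) :
    Prop where
  encloses : Encloses S Tbar L Ld
  metzler : ∀ τ ∈ Icc 0 Tbar, Metzler (S.A - L τ * S.Cyc)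
  nonneg_Gc : ∀ τ ∈ Icc 0 Tbar, Nonneg (S.Gc - L τ * S.Hyc)
  nonneg_Ec : ∀ τ ∈ Icc 0 Tbar, Nonneg (S.Ec - L τ * S.Fyc)
  nonneg_J : Nonneg (S.J - Ld * S.Cyd)
  nonneg_Gd : Nonneg (S.Gd - Ld * S.Hyd)
  nonneg_Ed : Nonneg (S.Ed - Ld * S.Fyd)
  stable : AsympStable S Tbar L Ld
  gain : HasHybridGain S Mc Md Tbar γ L Ld

end IntervalObs

/-! One linear copositive functional gives enclosure, stability and gain. For `excess σ x = |x| - σ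
x` and an error trajectory `e` with timer `τ = s - t k`, take the weighted sum of the `excess σ
(e_i)` with weights `μ_i(τ) = X_ii(min τ Tbar)`, add the integral of the `Uc`-weighted excess over
the delay window, and account for the impulse delay by the weights `q`, the column sums of `X(0)(Gd
- Ld Hyd)`. Since `X` is diagonal and `X L = Y`, the sign conditions of the linear program say that
the error dynamics are state-positive. Hence the excesses satisfy a componentwise differential
inequality with the same matrices, and the column conditions make the functional decrease along the
flow and at the jumps, up to `γ` times the input (`sum_rate_le`, `jump_le`). Integrating and
telescoping gives `IsTraj.balance`.

With `σ = 1` the excess is twice the negative part. Ordered data make the right-hand side of the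
balance vanish, so the errors stay nonnegative, which is the enclosure. With `σ = 0` the excess is
the absolute value, and the balance gives Lyapunov stability and the gain, the output weights being
part of the decrease.

Convergence is the delicate point, because the functional need not decrease strictly between
impulses. The balance makes the losses between impulses and the values `e (t k)` summable, so both
tend to zero, but the delay window before an impulse must be controlled as well. There
`exp_mul_abs_le` is used: a component decays at a rate of at most `α / κ`, except for what the
functional loses. Small values at an impulse and a small loss therefore force small values on the
preceding window, and restarting the estimate at `t k` concludes, however long the dwell-time.

Since `X` is only differentiable, absolute continuity of the weights needs an argument: the column
condition bounds `X'` from above, and a derivative bounded above is integrable. -/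

namespace IntervalObs

/-! ### The excess function and its slope. -/

/-- The function `|x| - σ x`: for `σ = 0` this is `|x|`, and for `σ = 1` it is twice the negative
part of `x`. -/
def excess (σ x : ℝ) : ℝ := |x| - σ * x

theorem excess_nonneg {σ : ℝ} (hσ : |σ| ≤ 1) (x : ℝ) : 0 ≤ excess σ x := by
  have h1 : σ * x ≤ |σ| * |x| := by rw [← abs_mul]; exact le_abs_self _
  have h2 : |σ| * |x| ≤ 1 * |x| := by gcongr
  unfold excess; linarith

theorem excess_zero_left (x : ℝ) : excess 0 x = |x| := by simp [excess]

theorem excess_one_eq_zero {x : ℝ} : excess 1 x = 0 ↔ 0 ≤ x := by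
  simp [excess, sub_eq_zero, abs_eq_self]

theorem excess_add_le (σ x y : ℝ) : excess σ (x + y) ≤ excess σ x + excess σ y := by
  have := abs_add_le x y
  unfold excess; linarith

theorem excess_mul {a : ℝ} (ha : 0 ≤ a) (σ x : ℝ) : excess σ (a * x) = a * excess σ x := by
  unfold excess; rw [abs_mul, abs_of_nonneg ha]; ring

theorem excess_sum_le {ι : Type*} (σ : ℝ) (s : Finset ι) (f : ι → ℝ) :
    excess σ (∑ i ∈ s, f i) ≤ ∑ i ∈ s, excess σ (f i) :=
  Finset.le_sum_of_subadditive _ (by simp [excess]) (excess_add_le σ) s f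

theorem excess_mulVec_le {m n : ℕ} {M : Matrix (Fin m) (Fin n) ℝ} (hM : Nonneg M) (σ : ℝ)
    (v : Vec n) (i : Fin m) : excess σ ((M *ᵥ v) i) ≤ ∑ j, M i j * excess σ (v j) := by
  refine (excess_sum_le σ Finset.univ fun j => M i j * v j).trans_eq ?_
  exact Finset.sum_congr rfl fun j _ => excess_mul (hM i j) _ _

theorem continuous_excess (σ : ℝ) : Continuous (excess σ) := by unfold excess; fun_prop

/-- The slope `sign x - σ` of `excess σ` at `x`, times `z`, is at most `excess σ z`. -/
theorem sign_sub_mul_le (σ x z : ℝ) : ((SignType.sign x : ℝ) - σ) * z ≤ excess σ z := by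
  have : (SignType.sign x : ℝ) * z ≤ |z| := by
    rcases lt_trichotomy x 0 with h | h | h
    · simpa [h] using neg_le_abs z
    · simp [h]
    · simpa [h] using le_abs_self z
  unfold excess; linarith

/-- The equality case of `sign_sub_mul_le`. It serves the diagonal entries of the flow matrix, whose
sign is unknown, so that Metzler suffices. -/
theorem sign_sub_mul_self (σ x : ℝ) : ((SignType.sign x : ℝ) - σ) * x = excess σ x := by
  unfold excess; rw [sub_mul, sign_mul_self]

/-- At a point where both `f` and `|f|` are differentiable, `|f|' = sign f * f'`. -/
theorem hasDerivAt_abs_of_differentiableAt {f : ℝ → ℝ} {f' s : ℝ} (hf : HasDerivAt f f' s)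
    (h : DifferentiableAt ℝ (fun r => |f r|) s) :
    HasDerivAt (fun r => |f r|) ((SignType.sign (f s) : ℝ) * f') s := by
  by_cases h0 : f s = 0
  -- At a zero of `f` the function `|f|` is minimal, so its derivative vanishes, in agreement with
  -- `sign 0 = 0`.
  · have hmin : IsLocalMin (fun r => |f r|) s :=
      Eventually.of_forall fun r => by simp [h0]
    have := h.hasDerivAt
    rw [hmin.deriv_eq_zero] at this
    simpa [h0] using this
  · exact (hasDerivAt_abs h0).comp s hf

end IntervalObs

/-! ### Absolutely continuous functions. -/

theorem AbsolutelyContinuousOnInterval.abs {f : ℝ → ℝ} {a b : ℝ}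
    (hf : AbsolutelyContinuousOnInterval f a b) :
    AbsolutelyContinuousOnInterval (fun s => |f s|) a b := by
  refine squeeze_zero (fun E => Finset.sum_nonneg fun i _ => dist_nonneg) (fun E => ?_) hf
  refine Finset.sum_le_sum fun i _ => ?_
  simpa [Real.dist_eq] using abs_abs_sub_abs_le _ _

theorem AbsolutelyContinuousOnInterval.finsetSum {ι : Type*} {f : ι → ℝ → ℝ} {a b : ℝ}
    (s : Finset ι) (hf : ∀ i ∈ s, AbsolutelyContinuousOnInterval (f i) a b) :
    AbsolutelyContinuousOnInterval (fun r => ∑ i ∈ s, f i r) a b := by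
  classical
  induction s using Finset.induction_on with
  | empty =>
    simpa using ((LipschitzWith.const (0 : ℝ)).lipschitzOnWith (s := uIcc a b)).absolutelyContinuousOnInterval
  | insert i s hi ih =>
    simp only [Finset.sum_insert hi]
    exact (hf i (by simp)).fun_add (ih fun j hj => hf j (by simp [hj]))

theorem AbsolutelyContinuousOnInterval.const_fun (c a b : ℝ) :
    AbsolutelyContinuousOnInterval (fun _ => c) a b :=
  ((LipschitzWith.const c).lipschitzOnWith (s := uIcc a b)).absolutelyContinuousOnInterval

theorem AbsolutelyContinuousOnInterval.congr_fun {f g : ℝ → ℝ} {a b : ℝ}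
    (hf : AbsolutelyContinuousOnInterval f a b) (h : EqOn f g (uIcc a b)) :
    AbsolutelyContinuousOnInterval g a b := by
  rw [absolutelyContinuousOnInterval_iff] at hf ⊢
  intro ε hε
  obtain ⟨δ, hδ, H⟩ := hf ε hε
  refine ⟨δ, hδ, fun E hE h1 => ?_⟩
  rw [← Finset.sum_congr rfl fun i hi => ?_]
  · exact H E hE h1
  · rw [h (hE.1 i hi).1, h (hE.1 i hi).2]

theorem AbsolutelyContinuousOnInterval.comp_sub_const {f : ℝ → ℝ} {a b c : ℝ}
    (hf : AbsolutelyContinuousOnInterval f (a - c) (b - c)) :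
    AbsolutelyContinuousOnInterval (fun s => f (s - c)) a b := by
  rw [absolutelyContinuousOnInterval_iff] at hf ⊢
  intro ε hε
  obtain ⟨δ, hδ, H⟩ := hf ε hε
  refine ⟨δ, hδ, fun E hE h1 => ?_⟩
  have hmem : ∀ x ∈ uIcc a b, x - c ∈ uIcc (a - c) (b - c) := fun x hx => by
    rw [← Set.image_sub_const_uIcc]; exact ⟨x, hx, rfl⟩
  refine H (E.1, fun i => ((E.2 i).1 - c, (E.2 i).2 - c)) ⟨fun i hi => ?_, ?_⟩ ?_
  · exact ⟨hmem _ (hE.1 i hi).1, hmem _ (hE.1 i hi).2⟩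
  · intro i hi j hj hij
    have := hE.2 hi hj hij
    simp only [Function.onFun] at this ⊢
    have hsh : ∀ p q x : ℝ, x ∈ uIoc (p - c) (q - c) → x + c ∈ uIoc p q := fun p q x hx => by
      simpa only [mem_uIoc, sub_lt_iff_lt_add, le_sub_iff_add_le] using hx
    rw [Set.disjoint_left] at this ⊢
    exact fun x hx hx' => this (hsh _ _ x hx) (hsh _ _ x hx')
  · simpa [Real.dist_eq] using h1

/-- An absolutely continuous function grows at most by the integral of an a.e. bound of its
derivative. -/
theorem AbsolutelyContinuousOnInterval.sub_le_integral {F g : ℝ → ℝ} {a b : ℝ} (hab : a ≤ b)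
    (hF : AbsolutelyContinuousOnInterval F a b) (hg : IntervalIntegrable g volume a b)
    (h : ∀ᵐ s, s ∈ Ioo a b → ∃ F', HasDerivAt F F' s ∧ F' ≤ g s) :
    F b - F a ≤ ∫ s in a..b, g s := by
  rw [← hF.integral_deriv_eq_sub]
  refine intervalIntegral.integral_mono_ae_restrict hab hF.intervalIntegrable_deriv hg ?_
  have hb : ∀ᵐ s : ℝ, s ≠ b := by simp [ae_iff, measure_singleton]
  have ha : ∀ᵐ s : ℝ, s ≠ a := by simp [ae_iff, measure_singleton]
  rw [EventuallyLE, ae_restrict_iff' measurableSet_Icc]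
  filter_upwards [h, ha, hb] with s hs hsa hsb hsm
  obtain ⟨F', h1, h2⟩ := hs ⟨lt_of_le_of_ne hsm.1 hsa.symm, lt_of_le_of_ne hsm.2 hsb⟩
  rwa [h1.deriv]

/-- A derivative that is bounded above is integrable. -/
theorem intervalIntegrable_of_deriv_le {f f' : ℝ → ℝ} {a b c : ℝ} (hab : a ≤ b)
    (hf : ContinuousOn f (Icc a b)) (hd : ∀ s ∈ Ioo a b, HasDerivAt f (f' s) s)
    (hc : ∀ s ∈ Ioo a b, f' s ≤ c) : IntervalIntegrable f' volume a b := by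
  -- The function `c * s - f s` has the nonnegative derivative `c - f'`, and nonnegative derivatives
  -- are integrable.
  have hint : IntervalIntegrable (fun s => c - f' s) volume a b := by
    refine intervalIntegral.intervalIntegrable_deriv_of_nonneg (g := fun s => c * s - f s) ?_ ?_ ?_
    · rw [uIcc_of_le hab]; fun_prop
    · rw [min_eq_left hab, max_eq_right hab]
      intro s hs
      simpa using ((hasDerivAt_id' s).const_mul c).fun_sub (hd s hs)
    · rw [min_eq_left hab, max_eq_right hab]
      intro s hs
      linarith [hc s hs]
  have := (intervalIntegrable_const (c := c) (μ := volume) (a := a) (b := b)).sub hint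
  simpa using this

/-- A continuous function with an integrable derivative, up to countably many points, is absolutely
continuous. -/
theorem AbsolutelyContinuousOnInterval.of_hasDerivAt_off_countable {f f' : ℝ → ℝ} {a b : ℝ}
    (hab : a ≤ b) {s : Set ℝ} (hs : s.Countable) (hf : ContinuousOn f (Icc a b))
    (hd : ∀ x ∈ Ioo a b \ s, HasDerivAt f (f' x) x) (hi : IntervalIntegrable f' volume a b) :
    AbsolutelyContinuousOnInterval f a b := by
  refine ((AbsolutelyContinuousOnInterval.const_fun (f a) a b).fun_add
    (hi.absolutelyContinuousOnInterval_intervalIntegral left_mem_uIcc)).congr_fun ?_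
  intro x hx
  rw [uIcc_of_le hab] at hx
  have : ∫ y in a..x, f' y = f x - f a := by
    refine integral_eq_of_hasDerivAt_off_countable_of_le f f' hx.1 hs
      (hf.mono (Icc_subset_Icc_right hx.2))
      (fun y hy => hd y ⟨⟨hy.1.1, hy.1.2.trans_le hx.2⟩, hy.2⟩) (hi.mono_set ?_)
    rw [uIcc_of_le hx.1, uIcc_of_le hab]; exact Icc_subset_Icc_right hx.2
  simp only [this]; ring

/-! ### Weighted excesses, the certificate and its pointwise inequalities. -/

namespace IntervalObs

/-- The weighted sum `∑ c_j (|x_j| - σ x_j)`. -/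
def wexcess {n : ℕ} (σ : ℝ) (c x : Vec n) : ℝ := ∑ j, c j * excess σ (x j)

theorem wexcess_nonneg {n : ℕ} {σ : ℝ} (hσ : |σ| ≤ 1) {c : Vec n} (hc : ∀ j, 0 ≤ c j)
    (x : Vec n) : 0 ≤ wexcess σ c x :=
  Finset.sum_nonneg fun j _ => mul_nonneg (hc j) (excess_nonneg hσ _)

theorem wexcess_mono {n : ℕ} {σ : ℝ} (hσ : |σ| ≤ 1) {c c' : Vec n} (h : ∀ j, c j ≤ c' j)
    (x : Vec n) : wexcess σ c x ≤ wexcess σ c' x :=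
  Finset.sum_le_sum fun j _ => mul_le_mul_of_nonneg_right (h j) (excess_nonneg hσ _)

theorem wexcess_add {n : ℕ} (σ : ℝ) (c c' x : Vec n) :
    wexcess σ (c + c') x = wexcess σ c x + wexcess σ c' x := by
  simp [wexcess, add_mul, Finset.sum_add_distrib]

theorem wexcess_sub {n : ℕ} (σ : ℝ) (c c' x : Vec n) :
    wexcess σ (c - c') x = wexcess σ c x - wexcess σ c' x := by
  simp [wexcess, sub_mul, Finset.sum_sub_distrib]

theorem wexcess_smul {n : ℕ} (σ a : ℝ) (c x : Vec n) :
    wexcess σ (a • c) x = a * wexcess σ c x := by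
  simp [wexcess, mul_assoc, Finset.mul_sum]

theorem wexcess_zero_one {n : ℕ} (x : Vec n) : wexcess 0 1 x = oneNorm x := by
  simp [wexcess, oneNorm, excess_zero_left]

theorem continuous_wexcess {n : ℕ} (σ : ℝ) (c : Vec n) : Continuous (wexcess σ c) := by
  have := continuous_excess σ
  unfold wexcess; fun_prop

/-- Linear systems with state-positive flow and jump maps depending on a timer, together with a
linear copositive certificate: weights `μ` on the state that decrease along the flow up to the
delay weights `U`, the output weights `m` and the input level `γ`, and a decrease at the jumps. -/
structure Certificate (n pc pd : ℕ) where
  T : ℝ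
  T_pos : 0 < T
  B : ℝ → Matrix (Fin n) (Fin n) ℝ
  G : ℝ → Matrix (Fin n) (Fin n) ℝ
  E : ℝ → Matrix (Fin n) (Fin pc) ℝ
  J : Matrix (Fin n) (Fin n) ℝ
  H : Matrix (Fin n) (Fin n) ℝ
  F : Matrix (Fin n) (Fin pd) ℝ
  μ : ℝ → Vec n
  dμ : ℝ → Vec n
  U : Vec n
  m : Vec n
  r : Vec n
  α : ℝ
  κ : ℝ
  γ : ℝ
  ε : ℝ
  α_pos : 0 < α
  κ_pos : 0 < κ
  γ_pos : 0 < γ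
  ε_pos : 0 < ε
  U_nonneg : ∀ j, 0 ≤ U j
  m_nonneg : ∀ j, 0 ≤ m j
  r_nonneg : ∀ j, 0 ≤ r j
  metzler : ∀ τ, 0 < τ → Metzler (B τ)
  G_nonneg : ∀ τ, 0 < τ → Nonneg (G τ)
  E_nonneg : ∀ τ, 0 < τ → Nonneg (E τ)
  J_nonneg : Nonneg J
  H_nonneg : Nonneg H
  F_nonneg : Nonneg F
  κ_le : ∀ τ, 0 ≤ τ → ∀ i, κ ≤ μ τ i
  μ_ac : ∀ b, 0 ≤ b → ∀ i, AbsolutelyContinuousOnInterval (fun τ => μ τ i) 0 b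
  μ_deriv : ∀ τ, 0 < τ → τ ≠ T → ∀ i, HasDerivAt (fun τ => μ τ i) (dμ τ i) τ
  μ_const : ∀ τ, T ≤ τ → μ τ = μ T
  diag_ge : ∀ τ, 0 < τ → ∀ i, -α ≤ μ τ i * B τ i i
  col_B : ∀ τ, 0 < τ → ∀ j, dμ τ j + ∑ i, μ τ i * B τ i j + U j + m j ≤ 0
  col_G : ∀ τ, 0 < τ → ∀ j, ∑ i, μ τ i * G τ i j ≤ U j
  col_E : ∀ τ, 0 < τ → ∀ j, ∑ i, μ τ i * E τ i j ≤ γ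
  col_J : ∀ j, ∑ i, μ 0 i * J i j + ∑ i, μ 0 i * H i j + ε + r j ≤ μ T j
  col_F : ∀ j, ∑ i, μ 0 i * F i j ≤ γ

namespace Certificate

variable {n pc pd : ℕ} (C : Certificate n pc pd)

theorem μ_nonneg {τ : ℝ} (hτ : 0 ≤ τ) (i : Fin n) : 0 ≤ C.μ τ i :=
  C.κ_pos.le.trans (C.κ_le τ hτ i)

/-- The weights of the delayed state at the jumps. -/
def q : Vec n := fun j => ∑ i, C.μ 0 i * C.H i j

theorem q_nonneg (j : Fin n) : 0 ≤ C.q j :=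
  Finset.sum_nonneg fun i _ => mul_nonneg (C.μ_nonneg le_rfl i) (C.H_nonneg i j)

/-- The right-hand side of the comparison system satisfied by the excesses. -/
def rowBound (σ τ : ℝ) (y d : Vec n) (w : Vec pc) (i : Fin n) : ℝ :=
  ∑ j, C.B τ i j * excess σ (y j) + ∑ j, C.G τ i j * excess σ (d j)
    + ∑ j, C.E τ i j * excess σ (w j)

/-- The slope of `excess σ` at `y i` multiplies each term of row `i`. A nonnegative coefficient
allows passing to the excess of its factor, and on the diagonal there is equality. -/
theorem sign_sub_mul_le_rowBound {σ τ : ℝ} (hτ : 0 < τ) (y d : Vec n) (w : Vec pc) (i : Fin n) :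
    ((SignType.sign (y i) : ℝ) - σ) * (C.B τ *ᵥ y + C.G τ *ᵥ d + C.E τ *ᵥ w) i
      ≤ C.rowBound σ τ y d w i := by
  simp only [Pi.add_apply, mul_add, rowBound, Matrix.mulVec, dotProduct, Finset.mul_sum]
  refine add_le_add (add_le_add ?_ ?_) ?_ <;> refine Finset.sum_le_sum fun j _ => ?_
  · by_cases hij : i = j
    · subst hij
      rw [mul_left_comm, sign_sub_mul_self]
    · rw [mul_left_comm]
      exact mul_le_mul_of_nonneg_left (sign_sub_mul_le _ _ _) (C.metzler τ hτ i j hij)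
  · rw [mul_left_comm]
    exact mul_le_mul_of_nonneg_left (sign_sub_mul_le _ _ _) (C.G_nonneg τ hτ i j)
  · rw [mul_left_comm]
    exact mul_le_mul_of_nonneg_left (sign_sub_mul_le _ _ _) (C.E_nonneg τ hτ i j)

/-- Exchanging the sums turns row-wise bounds into column sums, the form in which the certificate
states its conditions. -/
theorem sum_mul_sum_le {m k : ℕ} {σ : ℝ} (hσ : |σ| ≤ 1) (a : Vec m) (M : Matrix (Fin m) (Fin k) ℝ)
    {c : Vec k} (h : ∀ j, ∑ i, a i * M i j ≤ c j) (x : Vec k) :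
    ∑ i, a i * ∑ j, M i j * excess σ (x j) ≤ wexcess σ c x := by
  simp only [Finset.mul_sum]
  rw [Finset.sum_comm]
  refine Finset.sum_le_sum fun j _ => ?_
  simp only [← mul_assoc, ← Finset.sum_mul]
  exact mul_le_mul_of_nonneg_right (h j) (excess_nonneg hσ _)

theorem sum_rowBound_le {σ τ : ℝ} (hσ : |σ| ≤ 1) (hτ : 0 < τ) (y d : Vec n) (w : Vec pc) :
    ∑ i, (C.dμ τ i * excess σ (y i) + C.μ τ i * C.rowBound σ τ y d w i)
      ≤ wexcess σ C.U d - wexcess σ (C.U + C.m) y + C.γ * wexcess σ 1 w := by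
  have h1 := sum_mul_sum_le hσ (C.μ τ) (C.B τ) (c := fun j => -C.dμ τ j - (C.U j + C.m j))
    (fun j => by linarith [C.col_B τ hτ j]) y
  have h2 := sum_mul_sum_le hσ (C.μ τ) (C.G τ) (C.col_G τ hτ) d
  have h3 := sum_mul_sum_le hσ (C.μ τ) (C.E τ) (c := C.γ • 1)
    (fun j => by simpa using C.col_E τ hτ j) w
  rw [wexcess_smul] at h3
  have h4 : wexcess σ (fun j => -C.dμ τ j - (C.U j + C.m j)) y
      = -∑ i, C.dμ τ i * excess σ (y i) - wexcess σ (C.U + C.m) y := by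
    simp [wexcess, sub_mul, Finset.sum_sub_distrib]
  simp only [rowBound, mul_add, Finset.sum_add_distrib] at *
  linarith

theorem sum_rate_le {σ τ : ℝ} (hσ : |σ| ≤ 1) (hτ : 0 < τ) (y d : Vec n) (w : Vec pc) :
    ∑ i, (C.dμ τ i * excess σ (y i) + C.μ τ i * (((SignType.sign (y i) : ℝ) - σ)
        * (C.B τ *ᵥ y + C.G τ *ᵥ d + C.E τ *ᵥ w) i))
      ≤ wexcess σ C.U d - wexcess σ (C.U + C.m) y + C.γ * wexcess σ 1 w := by
  refine le_trans (Finset.sum_le_sum fun i _ => ?_) (C.sum_rowBound_le hσ hτ y d w)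
  gcongr
  · exact C.μ_nonneg hτ.le i
  · exact C.sign_sub_mul_le_rowBound hτ y d w i

/-- A single component cannot decrease much faster than the whole certificate. -/
theorem le_component_rate {τ : ℝ} (hτ : 0 < τ) (y d : Vec n) (i : Fin n) :
    ∑ k, (C.dμ τ k * |y k| + C.μ τ k * ((SignType.sign (y k) : ℝ)
        * (C.B τ *ᵥ y + C.G τ *ᵥ d) k)) + wexcess 0 C.U y - wexcess 0 C.U d - C.α * |y i|
      ≤ C.μ τ i * ((SignType.sign (y i) : ℝ) * (C.B τ *ᵥ y + C.G τ *ᵥ d) i) := by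
  have h0 : |(0 : ℝ)| ≤ 1 := by simp
  have h1 := C.sum_rowBound_le h0 hτ y d 0
  have hle : ∀ k, (SignType.sign (y k) : ℝ) * (C.B τ *ᵥ y + C.G τ *ᵥ d) k
      ≤ C.rowBound 0 τ y d 0 k := fun k => by
    simpa using C.sign_sub_mul_le_rowBound (σ := 0) hτ y d 0 k
  -- Every row falls short of its bound by a nonnegative amount, so the deficit of row `i` is at
  -- most the total deficit. The column conditions bound the sum of the row bounds (`h1`), and the
  -- row bound of `i` is at least its diagonal term (`h3`).
  have h2 : C.μ τ i * (C.rowBound 0 τ y d 0 i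
        - (SignType.sign (y i) : ℝ) * (C.B τ *ᵥ y + C.G τ *ᵥ d) i)
      ≤ ∑ k, C.μ τ k * (C.rowBound 0 τ y d 0 k
        - (SignType.sign (y k) : ℝ) * (C.B τ *ᵥ y + C.G τ *ᵥ d) k) :=
    Finset.single_le_sum (f := fun k => C.μ τ k * (C.rowBound 0 τ y d 0 k
        - (SignType.sign (y k) : ℝ) * (C.B τ *ᵥ y + C.G τ *ᵥ d) k))
      (fun k _ => mul_nonneg (C.μ_nonneg hτ.le k) (sub_nonneg.2 (hle k))) (Finset.mem_univ i)
  have h3 : C.B τ i i * |y i| ≤ C.rowBound 0 τ y d 0 i := by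
    have e1 : C.B τ i i * |y i| ≤ ∑ j, C.B τ i j * excess 0 (y j) := by
      rw [← Finset.add_sum_erase _ _ (Finset.mem_univ i), excess_zero_left]
      refine le_add_of_nonneg_right (Finset.sum_nonneg fun j hj => ?_)
      exact mul_nonneg (C.metzler τ hτ i j (Finset.ne_of_mem_erase hj).symm) (excess_nonneg h0 _)
    have e2 : 0 ≤ ∑ j, C.G τ i j * excess 0 (d j) :=
      Finset.sum_nonneg fun j _ => mul_nonneg (C.G_nonneg τ hτ i j) (excess_nonneg h0 _)
    have e3 : 0 ≤ ∑ j, C.E τ i j * excess 0 ((0 : Vec pc) j) :=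
      Finset.sum_nonneg fun j _ => mul_nonneg (C.E_nonneg τ hτ i j) (excess_nonneg h0 _)
    unfold rowBound; linarith
  have h4 := mul_le_mul_of_nonneg_left h3 (C.μ_nonneg hτ.le i)
  have h5 := mul_le_mul_of_nonneg_right (C.diag_ge τ hτ i) (abs_nonneg (y i))
  have h6 := wexcess_nonneg h0 C.m_nonneg y
  have h7 : wexcess 0 1 (0 : Vec pc) = 0 := by simp [wexcess, excess]
  rw [h7] at h1
  simp only [wexcess_add, excess_zero_left, Finset.sum_add_distrib, mul_sub,
    Finset.sum_sub_distrib] at *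
  linarith

/-- The certificate does not increase at a jump, up to the delayed state and the input. -/
theorem jump_le {σ : ℝ} (hσ : |σ| ≤ 1) (x p : Vec n) (w : Vec pd) :
    wexcess σ (C.μ 0) (C.J *ᵥ x + C.H *ᵥ p + C.F *ᵥ w) + C.ε * wexcess σ 1 x + wexcess σ C.r x
      + wexcess σ C.q x ≤ wexcess σ (C.μ C.T) x + wexcess σ C.q p + C.γ * wexcess σ 1 w := by
  have h0 : wexcess σ (C.μ 0) (C.J *ᵥ x + C.H *ᵥ p + C.F *ᵥ w)
      ≤ ∑ i, C.μ 0 i * ∑ j, C.J i j * excess σ (x j) + ∑ i, C.μ 0 i * ∑ j, C.H i j * excess σ (p j)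
        + ∑ i, C.μ 0 i * ∑ j, C.F i j * excess σ (w j) := by
    rw [← Finset.sum_add_distrib, ← Finset.sum_add_distrib]
    refine Finset.sum_le_sum fun i _ => ?_
    rw [← mul_add, ← mul_add]
    refine mul_le_mul_of_nonneg_left ?_ (C.μ_nonneg le_rfl i)
    have e1 := excess_add_le σ ((C.J *ᵥ x) i + (C.H *ᵥ p) i) ((C.F *ᵥ w) i)
    have e2 := excess_add_le σ ((C.J *ᵥ x) i) ((C.H *ᵥ p) i)
    have e3 := excess_mulVec_le C.J_nonneg σ x i
    have e4 := excess_mulVec_le C.H_nonneg σ p i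
    have e5 := excess_mulVec_le C.F_nonneg σ w i
    simp only [Pi.add_apply]; linarith
  -- This is `col_J` solved for the columns of `J`; the part coming from `H` is the weight `q`.
  have h1 := sum_mul_sum_le hσ (C.μ 0) C.J (c := C.μ C.T - C.q - C.ε • 1 - C.r)
    (fun j => by simp [q]; linarith [C.col_J j]) x
  have h2 := sum_mul_sum_le hσ (C.μ 0) C.H (c := C.q) (fun j => le_rfl) p
  have h3 := sum_mul_sum_le hσ (C.μ 0) C.F (c := C.γ • 1) (fun j => by simpa using C.col_F j) w
  rw [wexcess_smul] at h3
  simp only [wexcess_sub, wexcess_smul] at h1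
  linarith

end Certificate

end IntervalObs

/-! ### The certificate along a single Carathéodory flow. -/

namespace IntervalObs

theorem IntervalIntegrable_apply {n : ℕ} {f : ℝ → Vec n} {a b : ℝ}
    (hf : IntervalIntegrable f volume a b) (i : Fin n) :
    IntervalIntegrable (fun s => f s i) volume a b :=
  ⟨hf.1.eval i, hf.2.eval i⟩

/-- The solution of `y' = f` with initial value `y0` at time `a`. -/
noncomputable def flow {n : ℕ} (a : ℝ) (y0 : Vec n) (f : ℝ → Vec n) (s : ℝ) : Vec n :=
  y0 + ∫ r in a..s, f r

section flow

variable {n : ℕ} {f : ℝ → Vec n} {a b : ℝ}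

theorem flow_self (y0 : Vec n) : flow a y0 f a = y0 := by simp [flow]

theorem flow_apply (hf : IntervalIntegrable f volume a b) (y0 : Vec n) {s : ℝ}
    (hs : s ∈ uIcc a b) (i : Fin n) : flow a y0 f s i = y0 i + ∫ r in a..s, f r i := by
  have hfs : IntervalIntegrable f volume a s := hf.mono_set (uIcc_subset_uIcc_left hs)
  have := (ContinuousLinearMap.proj (R := ℝ) (φ := fun _ : Fin n => ℝ) i).intervalIntegral_comp_comm
    hfs
  simp only [ContinuousLinearMap.proj_apply] at this
  rw [flow, Pi.add_apply, ← this]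

theorem flow_ac (hf : IntervalIntegrable f volume a b) (y0 : Vec n) (i : Fin n) :
    AbsolutelyContinuousOnInterval (fun s => flow a y0 f s i) a b :=
  ((AbsolutelyContinuousOnInterval.const_fun (y0 i) a b).fun_add
    ((IntervalIntegrable_apply hf i).absolutelyContinuousOnInterval_intervalIntegral
      left_mem_uIcc)).congr_fun fun _ hs => (flow_apply hf y0 hs i).symm

theorem flow_continuousOn (hf : IntervalIntegrable f volume a b) (y0 : Vec n) :
    ContinuousOn (flow a y0 f) (uIcc a b) :=
  continuousOn_pi.2 fun i => (flow_ac hf y0 i).continuousOn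

/-- Lebesgue differentiation handles the flow. Its absolute value is absolutely continuous, hence
differentiable almost everywhere, and its derivative is then determined by that of the flow. -/
theorem ae_hasDerivAt_flow (hf : IntervalIntegrable f volume a b) (hab : a ≤ b) (y0 : Vec n) :
    ∀ᵐ s, s ∈ Ioo a b → ∀ i, HasDerivAt (fun r => flow a y0 f r i) (f s i) s ∧
      HasDerivAt (fun r => |flow a y0 f r i|) ((SignType.sign (flow a y0 f s i) : ℝ) * f s i) s := by
  have h1 : ∀ᵐ s, ∀ i, s ∈ uIcc a b → ∀ c ∈ uIcc a b,
      HasDerivAt (fun x => ∫ t in c..x, f t i) (f s i) s :=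
    ae_all_iff.2 fun i => (IntervalIntegrable_apply hf i).ae_hasDerivAt_integral
  have h2 : ∀ᵐ s, ∀ i, s ∈ uIcc a b → DifferentiableAt ℝ (fun r => |flow a y0 f r i|) s :=
    ae_all_iff.2 fun i => (flow_ac hf y0 i).abs.ae_differentiableAt
  filter_upwards [h1, h2] with s h1 h2 hs i
  have hs' : s ∈ uIcc a b := by rw [uIcc_of_le hab]; exact Ioo_subset_Icc_self hs
  have hd : HasDerivAt (fun r => flow a y0 f r i) (f s i) s := by
    refine ((h1 i hs' a left_mem_uIcc).const_add (y0 i)).congr_of_eventuallyEq ?_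
    filter_upwards [Icc_mem_nhds hs.1 hs.2] with r hr
    exact flow_apply hf y0 (by rwa [uIcc_of_le hab]) i
  exact ⟨hd, hasDerivAt_abs_of_differentiableAt hd (h2 i hs')⟩

end flow

namespace Certificate

variable {n pc pd : ℕ} (C : Certificate n pc pd) {a b : ℝ} {f : ℝ → Vec n}

/-- The copositive Lyapunov function along a flow that starts at time `a`. -/
noncomputable def lyap (σ a : ℝ) (y : ℝ → Vec n) (s : ℝ) : ℝ := wexcess σ (C.μ (s - a)) (y s)

theorem lyap_eq (σ a : ℝ) (y : ℝ → Vec n) : C.lyap σ a y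
    = fun s => ∑ i, C.μ (s - a) i * (|y s i| - σ * y s i) := rfl

theorem μ_ac_shift (hab : a ≤ b) (i : Fin n) :
    AbsolutelyContinuousOnInterval (fun s => C.μ (s - a) i) a b := by
  refine AbsolutelyContinuousOnInterval.comp_sub_const (f := fun s => C.μ s i) ?_
  rw [sub_self]
  exact C.μ_ac _ (sub_nonneg.2 hab) i

theorem lyap_ac (σ : ℝ) (hab : a ≤ b) (hf : IntervalIntegrable f volume a b) (y0 : Vec n) :
    AbsolutelyContinuousOnInterval (C.lyap σ a (flow a y0 f)) a b := by
  rw [lyap_eq]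
  refine AbsolutelyContinuousOnInterval.finsetSum _ fun i _ => ?_
  exact (C.μ_ac_shift hab i).fun_mul ((flow_ac hf y0 i).abs.fun_sub ((flow_ac hf y0 i).const_mul σ))

theorem ae_hasDerivAt_lyap (σ : ℝ) (hab : a ≤ b) (hf : IntervalIntegrable f volume a b)
    (y0 : Vec n) : ∀ᵐ s, s ∈ Ioo a b → HasDerivAt (C.lyap σ a (flow a y0 f))
      (∑ i, (C.dμ (s - a) i * excess σ (flow a y0 f s i) + C.μ (s - a) i
        * (((SignType.sign (flow a y0 f s i) : ℝ) - σ) * f s i))) s := by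
  -- The weights may have a kink where the timer reaches `T`; this single instant is discarded.
  have hT : ∀ᵐ s : ℝ, s ≠ a + C.T := by simp [ae_iff, measure_singleton]
  filter_upwards [ae_hasDerivAt_flow hf hab y0, hT] with s h hsT hs
  rw [lyap_eq]
  refine HasDerivAt.fun_sum fun i _ => ?_
  have hμ : HasDerivAt (fun r => C.μ (r - a) i) (C.dμ (s - a) i) s := by
    have := C.μ_deriv (s - a) (sub_pos.2 hs.1) (fun h => hsT (by linarith)) i
    simpa using HasDerivAt.comp_sub_const s a this
  have hy := ((h hs i).2).fun_sub (((h hs i).1).const_mul σ)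
  rw [sub_mul]
  exact hμ.fun_mul hy

/-- The right-hand side `f` of the flow, on `(a, b)`. -/
def IsFlowRhs (a b : ℝ) (f y d : ℝ → Vec n) (w : ℝ → Vec pc) : Prop :=
  ∀ s ∈ Ioo a b, f s = C.B (s - a) *ᵥ y s + C.G (s - a) *ᵥ d s + C.E (s - a) *ᵥ w s

theorem lyap_flow_le {σ : ℝ} (hσ : |σ| ≤ 1) (hab : a ≤ b) (hf : IntervalIntegrable f volume a b)
    (y0 : Vec n) {d : ℝ → Vec n} {w : ℝ → Vec pc} (h : C.IsFlowRhs a b f (flow a y0 f) d w)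
    (hd : IntervalIntegrable (fun s => wexcess σ C.U (d s)) volume a b)
    (hw : IntervalIntegrable (fun s => wexcess σ 1 (w s)) volume a b) :
    C.lyap σ a (flow a y0 f) b + (∫ s in a..b, wexcess σ (C.U + C.m) (flow a y0 f s))
      ≤ wexcess σ (C.μ 0) y0 + (∫ s in a..b, wexcess σ C.U (d s))
        + C.γ * ∫ s in a..b, wexcess σ 1 (w s) := by
  have hy : IntervalIntegrable (fun s => wexcess σ (C.U + C.m) (flow a y0 f s)) volume a b :=
    ((continuous_wexcess σ _).comp_continuousOn (flow_continuousOn hf y0)).intervalIntegrable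
  have key := (C.lyap_ac σ hab hf y0).sub_le_integral hab ((hd.sub hy).add (hw.const_mul C.γ)) (by
    filter_upwards [C.ae_hasDerivAt_lyap σ hab hf y0] with s hs hsm
    refine ⟨_, hs hsm, ?_⟩
    rw [h s hsm]
    exact C.sum_rate_le hσ (sub_pos.2 hsm.1) _ _ _)
  rw [intervalIntegral.integral_add (hd.sub hy) (hw.const_mul C.γ),
    intervalIntegral.integral_sub hd hy, intervalIntegral.integral_const_mul] at key
  have h0 : C.lyap σ a (flow a y0 f) a = wexcess σ (C.μ 0) y0 := by
    simp [lyap, flow_self]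
  linarith

/-- Backward estimate of a component along a flow without input: it was not much larger before,
except for what the certificate has lost in the meantime. -/
theorem exp_mul_abs_le (hab : a ≤ b) (hf : IntervalIntegrable f volume a b)
    (y0 : Vec n) {d : ℝ → Vec n} (h : C.IsFlowRhs a b f (flow a y0 f) d (fun _ => 0))
    (hd : IntervalIntegrable (fun s => wexcess 0 C.U (d s)) volume a b) {s : ℝ}
    (hs : s ∈ Icc a b) (i : Fin n) :
    Real.exp (C.α / C.κ * (s - b)) * |flow a y0 f s i| ≤ |flow a y0 f b i| + C.κ⁻¹ *
      (wexcess 0 (C.μ 0) y0 + (∫ s in a..b, wexcess 0 C.U (d s))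
        - C.lyap 0 a (flow a y0 f) b - ∫ s in a..b, wexcess 0 C.U (flow a y0 f s)) := by
  set y := flow a y0 f with hydef
  set c := C.α / C.κ with hc
  have h0 : |(0 : ℝ)| ≤ 1 := by simp
  have hκ := C.κ_pos
  have hyU : IntervalIntegrable (fun s => wexcess 0 C.U (y s)) volume a b :=
    ((continuous_wexcess 0 _).comp_continuousOn (flow_continuousOn hf y0)).intervalIntegrable
  set p : ℝ → ℝ := fun s => wexcess 0 C.U (y s) - wexcess 0 C.U (d s) with hp
  have hpi : IntervalIntegrable p volume a b := hyU.sub hd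
  have hsub : ∀ x z, x ∈ Icc a b → z ∈ Icc a b → uIcc x z ⊆ uIcc a b := fun x z hx hz => by
    rw [uIcc_of_le hab]; exact uIcc_subset_Icc hx hz
  -- The Lyapunov function corrected by the exchange with the delay terms. Without input it is
  -- nonincreasing, and its total drop is the bracket in the claim.
  set W : ℝ → ℝ := fun r => C.lyap 0 a y r + ∫ t in a..r, p t with hW
  have hWac : AbsolutelyContinuousOnInterval W a b := (C.lyap_ac 0 hab hf y0).fun_add
    (hpi.absolutelyContinuousOnInterval_intervalIntegral left_mem_uIcc)
  have hexp : AbsolutelyContinuousOnInterval (fun r => Real.exp (c * (r - b))) a b := by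
    refine ContDiffOn.absolutelyContinuousOnInterval ?_
    fun_prop
  -- the a.e. derivative of `W`
  have hWd : ∀ᵐ r, r ∈ Ioo a b → ∃ W', HasDerivAt W W' r ∧ W' ≤ 0 ∧
      W' - C.α * |y r i| ≤ C.μ (r - a) i * ((SignType.sign (y r i) : ℝ) * f r i) := by
    filter_upwards [C.ae_hasDerivAt_lyap 0 hab hf y0, hpi.ae_hasDerivAt_integral] with r h1 h2 hr
    have hr' : r ∈ uIcc a b := by rw [uIcc_of_le hab]; exact Ioo_subset_Icc_self hr
    have hr0 : 0 < r - a := sub_pos.2 hr.1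
    refine ⟨_, (h1 hr).add (h2 hr' a left_mem_uIcc), ?_, ?_⟩
    · have := C.sum_rate_le h0 hr0 (y r) (d r) 0
      have hm := wexcess_nonneg h0 C.m_nonneg (y r)
      have h7 : wexcess 0 1 (0 : Vec pc) = 0 := by simp [wexcess, excess]
      rw [h7, wexcess_add] at this
      have hfr := h r hr
      simp only [hp]
      rw [hfr]
      simp only [← hydef]
      have e : (fun _ => 0 : ℝ → Vec pc) r = 0 := rfl
      linarith
    · have := C.le_component_rate hr0 (y r) (d r) i
      have hfr := h r hr
      simp only [Matrix.mulVec_zero, add_zero] at hfr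
      rw [hfr]
      simp only [hp, excess_zero_left, sub_zero, ← hydef]
      linarith
  -- `W` is nonincreasing
  have hWs : W s ≤ W a := by
    have := (hWac.mono (hsub a s (left_mem_Icc.2 hab) hs)).sub_le_integral hs.1
      (g := fun _ => 0) (by simp) (by
        filter_upwards [hWd] with r hr hrm
        obtain ⟨W', h1, h2, -⟩ := hr ⟨hrm.1, hrm.2.trans_le hs.2⟩
        exact ⟨W', h1, h2⟩)
    simpa using this
  -- This difference is nonincreasing: if `x = |y i|` has slope `R`, then `R + c x ≥ κ⁻¹ W'` by
  -- `le_component_rate`, and the factor `exp ≤ 1` only helps because `W' ≤ 0`. Comparing its values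
  -- at `s` and `b` gives the estimate.
  have hbd : AbsolutelyContinuousOnInterval
      (fun r => C.κ⁻¹ * W r - Real.exp (c * (r - b)) * |y r i|) s b :=
    ((hWac.const_mul C.κ⁻¹).fun_sub (hexp.fun_mul (flow_ac hf y0 i).abs)).mono
      (hsub s b hs (right_mem_Icc.2 hab))
  have key := hbd.sub_le_integral hs.2 (g := fun _ => 0) (by simp) (by
    filter_upwards [hWd, ae_hasDerivAt_flow hf hab y0] with r hr hyr hrm
    have hrm' : r ∈ Ioo a b := ⟨hs.1.trans_lt hrm.1, hrm.2⟩
    obtain ⟨W', h1, h2, h3⟩ := hr hrm'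
    have he : HasDerivAt (fun r => Real.exp (c * (r - b))) (Real.exp (c * (r - b)) * c) r := by
      have := (((hasDerivAt_id' r).sub_const b).const_mul c).exp
      simpa using this
    refine ⟨_, (h1.const_mul C.κ⁻¹).fun_sub (he.fun_mul (hyr hrm' i).2), ?_⟩
    have hμ := C.κ_le (r - a) (sub_pos.2 hrm'.1).le i
    simp only [← hydef]
    set x := |y r i|
    set R := (SignType.sign (y r i) : ℝ) * f r i
    have hx : 0 ≤ x := abs_nonneg _
    have hμ0 : 0 < C.μ (r - a) i := hκ.trans_le hμ
    have hR : C.κ⁻¹ * W' ≤ R + c * x := by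
      have e1 : W' / C.μ (r - a) i ≤ R + C.α / C.μ (r - a) i * x := by
        rw [div_le_iff₀ hμ0]
        have : (R + C.α / C.μ (r - a) i * x) * C.μ (r - a) i = C.μ (r - a) i * R + C.α * x := by
          field_simp
        linarith
      have e2 : C.κ⁻¹ * W' ≤ W' / C.μ (r - a) i := by
        rw [div_eq_inv_mul]
        exact mul_le_mul_of_nonpos_right (inv_anti₀ hκ hμ) h2
      have e3 : C.α / C.μ (r - a) i * x ≤ c * x := by
        have := C.α_pos
        rw [hc]; gcongr
      linarith
    have hE1 : Real.exp (c * (r - b)) ≤ 1 := by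
      rw [Real.exp_le_one_iff]
      exact mul_nonpos_of_nonneg_of_nonpos (div_nonneg C.α_pos.le hκ.le) (by linarith [hrm.2])
    have hE0 := Real.exp_pos (c * (r - b))
    have hneg : C.κ⁻¹ * W' ≤ 0 := mul_nonpos_of_nonneg_of_nonpos (inv_nonneg.2 hκ.le) h2
    have e4 := mul_le_mul_of_nonneg_left hR hE0.le
    have e5 : C.κ⁻¹ * W' ≤ Real.exp (c * (r - b)) * (C.κ⁻¹ * W') := by
      have := mul_le_mul_of_nonpos_right hE1 hneg
      linarith
    have e6 : Real.exp (c * (r - b)) * c * x + Real.exp (c * (r - b)) * R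
      = Real.exp (c * (r - b)) * (R + c * x) := by ring
    linarith)
  have hWa : W a = wexcess 0 (C.μ 0) y0 := by simp [hW, lyap, hydef, flow_self]
  have hWb : W b = C.lyap 0 a y b + ((∫ t in a..b, wexcess 0 C.U (y t))
      - ∫ t in a..b, wexcess 0 C.U (d t)) := by
    simp only [hW, hp]
    rw [intervalIntegral.integral_sub hyU hd]
  have e7 : C.κ⁻¹ * W s ≤ C.κ⁻¹ * W a := mul_le_mul_of_nonneg_left hWs (inv_nonneg.2 hκ.le)
  simp only [sub_self, mul_zero, Real.exp_zero, one_mul, intervalIntegral.integral_zero] at key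
  have e8 : C.κ⁻¹ * (wexcess 0 (C.μ 0) y0 + (∫ s in a..b, wexcess 0 C.U (d s))
        - C.lyap 0 a y b - ∫ s in a..b, wexcess 0 C.U (y s)) = C.κ⁻¹ * W a - C.κ⁻¹ * W b := by
    rw [hWa, hWb]; ring
  rw [e8]
  linarith

end Certificate

end IntervalObs

/-! ### Impulse times, and the balance of the certificate along a trajectory. -/

namespace IntervalObs

section dwell

variable {T : ℝ} {t : ℕ → ℝ}

theorem IsMinDwell.lt_succ (hT : 0 < T) (ht : IsMinDwell T t) (k : ℕ) : t k < t (k + 1) := by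
  linarith [ht.2 k]

theorem IsMinDwell.strictMono (hT : 0 < T) (ht : IsMinDwell T t) : StrictMono t :=
  strictMono_nat_of_lt_succ (ht.lt_succ hT)

theorem IsMinDwell.nonneg (hT : 0 < T) (ht : IsMinDwell T t) (k : ℕ) : 0 ≤ t k := by
  rw [← ht.1]; exact (ht.strictMono hT).monotone (Nat.zero_le k)

theorem IsMinDwell.mul_le (ht : IsMinDwell T t) (k : ℕ) : k * T ≤ t k := by
  induction k with
  | zero => simp [ht.1]
  | succ k ih => have := ht.2 k; push_cast; linarith

theorem IsMinDwell.tendsto (hT : 0 < T) (ht : IsMinDwell T t) : Tendsto t atTop atTop :=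
  tendsto_atTop_mono ht.mul_le (tendsto_natCast_atTop_atTop.atTop_mul_const hT)

theorem IsMinDwell.exists_mem_Ioc (hT : 0 < T) (ht : IsMinDwell T t) {J : ℕ} {s : ℝ}
    (hs : t J < s) : ∃ k, J ≤ k ∧ s ∈ Ioc (t k) (t (k + 1)) := by
  classical
  have hex : ∃ k, s ≤ t k := ((ht.tendsto hT).eventually_ge_atTop s).exists
  have hne : Nat.find hex ≠ 0 := fun h => by
    have := Nat.find_spec hex
    rw [h, ht.1] at this
    linarith [ht.nonneg hT J]
  obtain ⟨k, hk⟩ := Nat.exists_eq_succ_of_ne_zero hne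
  have h1 : s ≤ t (k + 1) := by have := Nat.find_spec hex; rwa [hk] at this
  have h2 : t k < s := not_le.1 (Nat.find_min hex (by omega))
  refine ⟨k, ?_, h2, h1⟩
  by_contra! hkJ
  linarith [(ht.strictMono hT).monotone (Nat.succ_le_of_lt hkJ)]

end dwell

/-- The values with a delayed index sum up to at most the history plus the undelayed sum. -/
theorem sum_past_le {N k : ℕ} {ρ r : ℕ → ℝ} (hρ : ∀ j, 0 ≤ ρ j) (hr : ∀ j, 0 ≤ r j) :
    ∑ j ∈ Finset.range k, (if N ≤ j + 1 then r (j + 1 - N) else ρ (N - (j + 1)))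
      ≤ ∑ j ∈ Finset.Ico 1 N, ρ j + (r 0 + ∑ j ∈ Finset.range k, r (j + 1)) := by
  -- The two cases are compared separately: `j ↦ N - (j + 1)` is injective into `[1, N)`, and `j ↦ j
  -- + 1 - N` is injective into `[0, k]`, which is why `r 0` is included.
  rw [Finset.sum_ite, add_comm, add_comm (r 0), ← Finset.sum_range_succ' r k]
  gcongr
  · rw [← Finset.sum_image (f := ρ) (g := fun j => N - (j + 1))]
    · refine Finset.sum_le_sum_of_subset_of_nonneg (fun x hx => ?_) fun j _ _ => hρ j
      simp only [Finset.mem_image, Finset.mem_filter, Finset.mem_range, Finset.mem_Ico] at hx ⊢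
      omega
    · intro x hx y hy hxy
      simp only [Finset.coe_filter, Finset.mem_range, mem_ofPred_eq] at hx hy
      dsimp only at hxy
      omega
  · rw [← Finset.sum_image (f := r) (g := fun j => j + 1 - N)]
    · refine Finset.sum_le_sum_of_subset_of_nonneg (fun x hx => ?_) fun j _ _ => hr j
      simp only [Finset.mem_image, Finset.mem_filter, Finset.mem_range] at hx ⊢
      omega
    · intro x hx y hy hxy
      simp only [Finset.coe_filter, Finset.mem_range, mem_ofPred_eq] at hx hy
      dsimp only at hxy
      omega

namespace Certificate

variable {n pc pd : ℕ} (C : Certificate n pc pd)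

/-- The right-hand side of the flow between the impulses `k` and `k + 1`. -/
def rhs (h : ℝ) (t : ℕ → ℝ) (δc : ℝ → Vec pc) (e : ℝ → Vec n) (k : ℕ) (r : ℝ) : Vec n :=
  C.B (r - t k) *ᵥ e r + C.G (r - t k) *ᵥ e (r - h) + C.E (r - t k) *ᵥ δc r

/-- The jump map at the impulse `k`. -/
def jump (N : ℕ) (t : ℕ → ℝ) (δd : ℕ → Vec pd) (ψ : ℕ → Vec n) (e : ℝ → Vec n) (k : ℕ) : Vec n :=
  C.J *ᵥ e (t k) + C.H *ᵥ pastState N t e ψ k + C.F *ᵥ δd k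

/-- Trajectories of the system described by `C`. -/
def IsTraj (h : ℝ) (N : ℕ) (t : ℕ → ℝ) (δc : ℝ → Vec pc) (δd : ℕ → Vec pd) (ψ : ℕ → Vec n)
    (e : ℝ → Vec n) : Prop :=
  IsTrajectory h t e (C.rhs h t δc e) (C.jump N t δd ψ e)

/-- The state right after the impulse `k`. -/
def start (N : ℕ) (t : ℕ → ℝ) (δd : ℕ → Vec pd) (ψ : ℕ → Vec n) (e : ℝ → Vec n) (k : ℕ) : Vec n :=
  if k = 0 then e 0 else C.jump N t δd ψ e k

/-- What the certificate loses between the impulses `k` and `k + 1`. -/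
noncomputable def loss (σ h : ℝ) (N : ℕ) (t : ℕ → ℝ) (δc : ℝ → Vec pc) (δd : ℕ → Vec pd)
    (ψ : ℕ → Vec n) (e : ℝ → Vec n) (k : ℕ) : ℝ :=
  wexcess σ (C.μ 0) (C.start N t δd ψ e k) + (∫ s in t k..t (k + 1), wexcess σ C.U (e (s - h)))
    + C.γ * (∫ s in t k..t (k + 1), wexcess σ 1 (δc s))
    - C.lyap σ (t k) e (t (k + 1)) - ∫ s in t k..t (k + 1), wexcess σ C.U (e s)

/-- The contribution of the initial condition. -/
noncomputable def initBound (σ h : ℝ) (N : ℕ) (ψ : ℕ → Vec n) (e : ℝ → Vec n) : ℝ :=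
  wexcess σ (C.μ 0) (e 0) + (∫ s in (-h)..0, wexcess σ C.U (e s))
    + (∑ j ∈ Finset.Ico 1 N, wexcess σ C.q (ψ j) + wexcess σ C.q (e 0))

section trajectory

variable {C} {h : ℝ} {N : ℕ} {t : ℕ → ℝ} {δc : ℝ → Vec pc} {δd : ℕ → Vec pd} {ψ : ℕ → Vec n}
  {e : ℝ → Vec n} {σ : ℝ}

theorem IsTraj.eq_flow (he : C.IsTraj h N t δc δd ψ e) (k : ℕ) {s : ℝ}
    (hs : s ∈ Ioc (t k) (t (k + 1))) :
    e s = flow (t k) (C.start N t δd ψ e k) (C.rhs h t δc e k) s :=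
  he.flow k s hs

theorem IsTraj.intervalIntegrable_wexcess (hh : 0 < h) (ht : IsMinDwell C.T t)
    (he : C.IsTraj h N t δc δd ψ e) (σ : ℝ) (c : Vec n) {a b : ℝ} (ha : -h ≤ a) (hb : -h ≤ b) :
    IntervalIntegrable (fun s => wexcess σ c (e s)) volume a b := by
  have hstep : ∀ k, IntervalIntegrable (fun s => wexcess σ c (e s)) volume (-h) (t k) := by
    intro k
    induction k with
    | zero =>
      rw [ht.1]
      refine ((continuous_wexcess σ c).comp_continuousOn ?_).intervalIntegrable
      rw [uIcc_of_le (by linarith)]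
      exact he.init
    | succ k ih =>
      refine ih.trans ?_
      have h1 : IntervalIntegrable (fun s => wexcess σ c
          (flow (t k) (C.start N t δd ψ e k) (C.rhs h t δc e k) s)) volume (t k) (t (k + 1)) :=
        ((continuous_wexcess σ c).comp_continuousOn
          (flow_continuousOn (he.integrable k) _)).intervalIntegrable
      -- Trajectory and flow agree on the half-open interval only: at `t k` the trajectory has its
      -- value before the jump.
      refine h1.congr_ae ?_
      rw [EventuallyEq, uIoc_of_le (ht.lt_succ C.T_pos k).le, ae_restrict_iff' measurableSet_Ioc]
      exact Eventually.of_forall fun s hs => by rw [he.eq_flow k hs]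
  obtain ⟨k, hk⟩ := ((ht.tendsto C.T_pos).eventually_ge_atTop (max a b)).exists
  refine (hstep k).mono_set ?_
  have h1 : a ≤ t k := (le_max_left a b).trans hk
  have h2 : b ≤ t k := (le_max_right a b).trans hk
  rw [uIcc_of_le (ha.trans h1)]
  exact uIcc_subset_Icc ⟨ha, h1⟩ ⟨hb, h2⟩

theorem IsTraj.intervalIntegrable_delayed (hh : 0 < h) (ht : IsMinDwell C.T t)
    (he : C.IsTraj h N t δc δd ψ e) (σ : ℝ) (c : Vec n) {a b : ℝ} (ha : 0 ≤ a) (hb : 0 ≤ b) :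
    IntervalIntegrable (fun s => wexcess σ c (e (s - h))) volume a b := by
  have := (he.intervalIntegrable_wexcess hh ht σ c (a := a - h) (b := b - h)
    (by linarith) (by linarith)).comp_sub_right h
  simpa using this

/-- The delayed integral is the undelayed one plus the window before `a` minus the window before
`b`. In the balance these windows telescope, as in a Lyapunov–Krasovskii functional. -/
theorem IsTraj.integral_delayed (hh : 0 < h) (ht : IsMinDwell C.T t)
    (he : C.IsTraj h N t δc δd ψ e) (σ : ℝ) (c : Vec n) {a b : ℝ} (ha : 0 ≤ a) (hb : 0 ≤ b) :
    ∫ s in a..b, wexcess σ c (e (s - h)) = (∫ s in (a - h)..a, wexcess σ c (e s))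
      + (∫ s in a..b, wexcess σ c (e s)) - ∫ s in (b - h)..b, wexcess σ c (e s) := by
  rw [intervalIntegral.integral_comp_sub_right (fun s => wexcess σ c (e s)) h]
  have hi : ∀ {x y : ℝ}, -h ≤ x → -h ≤ y →
      IntervalIntegrable (fun s => wexcess σ c (e s)) volume x y := fun hx hy =>
    he.intervalIntegrable_wexcess hh ht σ c hx hy
  have h1 := intervalIntegral.integral_add_adjacent_intervals
    (hi (x := a - h) (y := a) (by linarith) (by linarith)) (hi (y := b) (by linarith) (by linarith))
  have h2 := intervalIntegral.integral_add_adjacent_intervals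
    (hi (x := a - h) (y := b - h) (by linarith) (by linarith))
    (hi (y := b) (by linarith) (by linarith))
  linarith

theorem IsTraj.isFlowRhs (he : C.IsTraj h N t δc δd ψ e) (k : ℕ) {b : ℝ} (hb : b ≤ t (k + 1)) :
    C.IsFlowRhs (t k) b (C.rhs h t δc e k)
      (flow (t k) (C.start N t δd ψ e k) (C.rhs h t δc e k)) (fun s => e (s - h)) δc := by
  intro s hs
  rw [← he.eq_flow k ⟨hs.1, hs.2.le.trans hb⟩]
  rfl

theorem IsTraj.integral_flow (he : C.IsTraj h N t δc δd ψ e) (k : ℕ) (σ : ℝ) (c : Vec n) {b : ℝ}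
    (hb : b ∈ Ioc (t k) (t (k + 1))) :
    ∫ s in t k..b, wexcess σ c (flow (t k) (C.start N t δd ψ e k) (C.rhs h t δc e k) s)
      = ∫ s in t k..b, wexcess σ c (e s) := by
  refine intervalIntegral.integral_congr_ae (Eventually.of_forall fun s hs => ?_)
  rw [uIoc_of_le hb.1.le] at hs
  rw [← he.eq_flow k ⟨hs.1, hs.2.trans hb.2⟩]

theorem IsTraj.intervalIntegrable_rhs (he : C.IsTraj h N t δc δd ψ e) (k : ℕ) {b : ℝ}
    (hb : b ∈ Ioc (t k) (t (k + 1))) :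
    IntervalIntegrable (C.rhs h t δc e k) volume (t k) b := by
  refine (he.integrable k).mono_set (uIcc_subset_uIcc_left ?_)
  rw [uIcc_of_le (hb.1.le.trans hb.2)]
  exact Ioc_subset_Icc_self hb

/-- Decrease of the certificate between two impulses. -/
theorem IsTraj.lyap_le (hh : 0 < h) (ht : IsMinDwell C.T t) (he : C.IsTraj h N t δc δd ψ e)
    (hσ : |σ| ≤ 1) (k : ℕ) {b : ℝ} (hb : b ∈ Ioc (t k) (t (k + 1)))
    (hw : IntervalIntegrable (fun s => wexcess σ 1 (δc s)) volume (t k) b) :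
    C.lyap σ (t k) e b + (∫ s in t k..b, wexcess σ C.U (e s)) + (∫ s in t k..b, wexcess σ C.m (e s))
      ≤ wexcess σ (C.μ 0) (C.start N t δd ψ e k) + (∫ s in t k..b, wexcess σ C.U (e (s - h)))
        + C.γ * ∫ s in t k..b, wexcess σ 1 (δc s) := by
  have htk := ht.nonneg C.T_pos k
  have hb0 : 0 ≤ b := htk.trans hb.1.le
  have := C.lyap_flow_le hσ hb.1.le (he.intervalIntegrable_rhs k hb) _ (he.isFlowRhs k hb.2)
    (he.intervalIntegrable_delayed hh ht σ C.U htk hb0) hw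
  rw [he.integral_flow k σ _ hb, lyap, ← he.eq_flow k hb] at this
  have hadd : ∫ s in t k..b, wexcess σ (C.U + C.m) (e s)
      = (∫ s in t k..b, wexcess σ C.U (e s)) + ∫ s in t k..b, wexcess σ C.m (e s) := by
    rw [← intervalIntegral.integral_add]
    · simp only [wexcess_add]
    · exact he.intervalIntegrable_wexcess hh ht σ _ (by linarith) (by linarith)
    · exact he.intervalIntegrable_wexcess hh ht σ _ (by linarith) (by linarith)
  rw [hadd] at this
  rw [lyap]
  linarith

/-- The output weight `m` is part of the flow decrease. Thus the loss is nonnegative, and it pays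
for the continuous output in the gain estimate. -/
theorem IsTraj.integral_le_loss (hh : 0 < h) (ht : IsMinDwell C.T t)
    (he : C.IsTraj h N t δc δd ψ e) (hσ : |σ| ≤ 1) (k : ℕ)
    (hw : IntervalIntegrable (fun s => wexcess σ 1 (δc s)) volume (t k) (t (k + 1))) :
    ∫ s in t k..t (k + 1), wexcess σ C.m (e s) ≤ C.loss σ h N t δc δd ψ e k := by
  have := he.lyap_le hh ht hσ k (right_mem_Ioc.2 (ht.lt_succ C.T_pos k)) hw
  unfold loss; linarith

theorem integral_wexcess_nonneg (hσ : |σ| ≤ 1) {c : Vec n} (hc : ∀ j, 0 ≤ c j) {a b : ℝ}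
    (hab : a ≤ b) : 0 ≤ ∫ s in a..b, wexcess σ c (e s) :=
  intervalIntegral.integral_nonneg hab fun _ _ => wexcess_nonneg hσ hc _

theorem IsTraj.loss_nonneg (hh : 0 < h) (ht : IsMinDwell C.T t)
    (he : C.IsTraj h N t δc δd ψ e) (hσ : |σ| ≤ 1) (k : ℕ)
    (hw : IntervalIntegrable (fun s => wexcess σ 1 (δc s)) volume (t k) (t (k + 1))) :
    0 ≤ C.loss σ h N t δc δd ψ e k :=
  (integral_wexcess_nonneg hσ C.m_nonneg (ht.lt_succ C.T_pos k).le).trans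
    (he.integral_le_loss hh ht hσ k hw)

/-- Decrease of the certificate at an impulse. -/
theorem start_succ_le (ht : IsMinDwell C.T t) (hσ : |σ| ≤ 1) (k : ℕ) :
    wexcess σ (C.μ 0) (C.start N t δd ψ e (k + 1)) + C.ε * wexcess σ 1 (e (t (k + 1)))
      + wexcess σ C.r (e (t (k + 1))) + wexcess σ C.q (e (t (k + 1)))
      ≤ C.lyap σ (t k) e (t (k + 1)) + wexcess σ C.q (pastState N t e ψ (k + 1))
        + C.γ * wexcess σ 1 (δd (k + 1)) := by
  -- The minimum dwell-time enters here: the timer has passed `T`, so the weights before the jump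
  -- are those at `T`.
  rw [lyap, C.μ_const _ (ht.2 k)]
  exact C.jump_le hσ _ _ _

theorem sum_past_wexcess_le (ht : IsMinDwell C.T t) (hσ : |σ| ≤ 1) (k : ℕ) :
    ∑ j ∈ Finset.range k, wexcess σ C.q (pastState N t e ψ (j + 1))
      ≤ ∑ j ∈ Finset.Ico 1 N, wexcess σ C.q (ψ j) + (wexcess σ C.q (e 0)
        + ∑ j ∈ Finset.range k, wexcess σ C.q (e (t (j + 1)))) := by
  have := sum_past_le (N := N) (k := k) (ρ := fun j => wexcess σ C.q (ψ j))
    (r := fun j => wexcess σ C.q (e (t j))) (fun j => wexcess_nonneg hσ C.q_nonneg _)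
    (fun j => wexcess_nonneg hσ C.q_nonneg _)
  rw [ht.1] at this
  refine le_trans (Finset.sum_le_sum fun j _ => ?_) this
  unfold pastState
  split_ifs <;> exact le_rfl

/-- Balance of the certificate up to the impulse `k`. -/
theorem IsTraj.balance (hh : 0 < h) (ht : IsMinDwell C.T t) (he : C.IsTraj h N t δc δd ψ e)
    (hσ : |σ| ≤ 1) (hw : ∀ b, 0 ≤ b → IntervalIntegrable (fun s => wexcess σ 1 (δc s)) volume 0 b)
    (k : ℕ) :
    wexcess σ (C.μ 0) (C.start N t δd ψ e k) + (∫ s in (t k - h)..t k, wexcess σ C.U (e s))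
      + ∑ j ∈ Finset.range k, (C.loss σ h N t δc δd ψ e j + C.ε * wexcess σ 1 (e (t (j + 1)))
        + wexcess σ C.r (e (t (j + 1))))
      ≤ C.initBound σ h N ψ e + C.γ * ((∫ s in 0..t k, wexcess σ 1 (δc s))
        + ∑ j ∈ Finset.range k, wexcess σ 1 (δd (j + 1))) := by
  -- The induction keeps both the delayed and the undelayed `q`-sums. They are cancelled only
  -- afterwards, up to the history, by `sum_past_wexcess_le`.
  have key : wexcess σ (C.μ 0) (C.start N t δd ψ e k) + (∫ s in (t k - h)..t k, wexcess σ C.U (e s))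
      + ∑ j ∈ Finset.range k, (C.loss σ h N t δc δd ψ e j + C.ε * wexcess σ 1 (e (t (j + 1)))
        + wexcess σ C.r (e (t (j + 1)))) + ∑ j ∈ Finset.range k, wexcess σ C.q (e (t (j + 1)))
      ≤ wexcess σ (C.μ 0) (e 0) + (∫ s in (-h)..0, wexcess σ C.U (e s))
        + ∑ j ∈ Finset.range k, wexcess σ C.q (pastState N t e ψ (j + 1))
        + C.γ * ((∫ s in 0..t k, wexcess σ 1 (δc s))
        + ∑ j ∈ Finset.range k, wexcess σ 1 (δd (j + 1))) := by
    induction k with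
    | zero => simp [start, ht.1]
    | succ k ih =>
      have hk := ht.nonneg C.T_pos k
      have hk1 := ht.nonneg C.T_pos (k + 1)
      have h1 := start_succ_le (C := C) (N := N) (δd := δd) (ψ := ψ) (e := e) ht hσ k
      have h2 := he.integral_delayed hh ht σ C.U hk hk1
      have h3 := intervalIntegral.integral_add_adjacent_intervals (hw _ hk)
        ((hw _ hk).symm.trans (hw _ hk1))
      rw [← h3]
      simp only [Finset.sum_range_succ]
      have h4 : C.loss σ h N t δc δd ψ e k = wexcess σ (C.μ 0) (C.start N t δd ψ e k)
        + (∫ s in t k..t (k + 1), wexcess σ C.U (e (s - h)))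
        + C.γ * (∫ s in t k..t (k + 1), wexcess σ 1 (δc s))
        - C.lyap σ (t k) e (t (k + 1)) - ∫ s in t k..t (k + 1), wexcess σ C.U (e s) := rfl
      simp only [mul_add] at ih ⊢
      linarith
  have := sum_past_wexcess_le (C := C) (N := N) (ψ := ψ) (e := e) ht hσ k
  unfold initBound
  linarith

/-- Bound of the state and of the integral outputs in terms of the initial condition and inputs. -/
theorem IsTraj.lyap_le_initBound (hh : 0 < h) (ht : IsMinDwell C.T t)
    (he : C.IsTraj h N t δc δd ψ e) (hσ : |σ| ≤ 1)
    (hw : ∀ b, 0 ≤ b → IntervalIntegrable (fun s => wexcess σ 1 (δc s)) volume 0 b)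
    (k : ℕ) {b : ℝ} (hb : b ∈ Ioc (t k) (t (k + 1))) :
    C.lyap σ (t k) e b ≤ C.initBound σ h N ψ e + C.γ * ((∫ s in 0..b, wexcess σ 1 (δc s))
        + ∑ j ∈ Finset.range k, wexcess σ 1 (δd (j + 1))) := by
  have hk := ht.nonneg C.T_pos k
  have hb0 := hk.trans hb.1.le
  have h1 := he.balance hh ht hσ hw k
  have h2 := he.lyap_le hh ht hσ k hb ((hw _ hk).symm.trans (hw _ hb0))
  have h3 := he.integral_delayed hh ht σ C.U hk hb0
  have h4 := integral_wexcess_nonneg (e := e) hσ C.U_nonneg (a := b - h) (b := b) (by linarith)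
  have h5 := integral_wexcess_nonneg (e := e) hσ C.m_nonneg hb.1.le
  have h6 : 0 ≤ ∑ j ∈ Finset.range k, (C.loss σ h N t δc δd ψ e j
      + C.ε * wexcess σ 1 (e (t (j + 1))) + wexcess σ C.r (e (t (j + 1)))) := by
    refine Finset.sum_nonneg fun j _ => ?_
    have e1 := he.loss_nonneg hh ht hσ j
      ((hw _ (ht.nonneg C.T_pos j)).symm.trans (hw _ (ht.nonneg C.T_pos (j + 1))))
    have e2 := wexcess_nonneg hσ (c := 1) (by simp) (e (t (j + 1)))
    have e3 := wexcess_nonneg hσ C.r_nonneg (e (t (j + 1)))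
    have := mul_nonneg C.ε_pos.le e2
    linarith
  rw [← intervalIntegral.integral_add_adjacent_intervals (hw _ hk)
    ((hw _ hk).symm.trans (hw _ hb0))]
  simp only [mul_add] at h1 ⊢
  linarith

end trajectory

end Certificate

end IntervalObs

/-! ### Convergence of the unforced trajectories. -/

namespace IntervalObs

theorem wexcess_zero_right {n : ℕ} (σ : ℝ) (c : Vec n) : wexcess σ c 0 = 0 := by
  simp [wexcess, excess]

theorem abs_le_oneNorm {n : ℕ} (v : Vec n) (i : Fin n) : |v i| ≤ oneNorm v :=
  Finset.single_le_sum (f := fun i => |v i|) (fun _ _ => abs_nonneg _) (Finset.mem_univ i)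

theorem oneNorm_nonneg {n : ℕ} (v : Vec n) : 0 ≤ oneNorm v :=
  Finset.sum_nonneg fun _ _ => abs_nonneg _

theorem continuous_oneNorm {n : ℕ} : Continuous (oneNorm : Vec n → ℝ) := by
  unfold oneNorm; fun_prop

namespace Certificate

variable {n pc pd : ℕ} {C : Certificate n pc pd}

theorem mul_oneNorm_le_lyap {a s : ℝ} (hs : a ≤ s) (y : ℝ → Vec n) :
    C.κ * oneNorm (y s) ≤ C.lyap 0 a y s := by
  rw [lyap, ← wexcess_zero_one, ← wexcess_smul]
  exact wexcess_mono (by simp) (fun i => by simpa using C.κ_le (s - a) (by linarith) i) _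

section convergence

variable {h : ℝ} {N : ℕ} {t : ℕ → ℝ} {ψ : ℕ → Vec n} {e : ℝ → Vec n}

theorem IsTraj.unforced_balance (hh : 0 < h) (ht : IsMinDwell C.T t)
    (he : C.IsTraj h N t (fun _ => 0) (fun _ => 0) ψ e) (k : ℕ) :
    ∑ j ∈ Finset.range k, (C.loss 0 h N t (fun _ => 0) (fun _ => 0) ψ e j
      + C.ε * oneNorm (e (t (j + 1)))) ≤ C.initBound 0 h N ψ e := by
  have h0 : |(0 : ℝ)| ≤ 1 := by simp
  have h1 := he.balance hh ht h0 (fun b _ => by simp [wexcess_zero_right]) k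
  have h2 := wexcess_nonneg h0 (C.μ_nonneg le_rfl)
    (C.start N t (fun _ => 0) ψ e k)
  have h3 := integral_wexcess_nonneg (e := e) h0 C.U_nonneg (a := t k - h) (b := t k) (by linarith)
  have h4 : 0 ≤ ∑ j ∈ Finset.range k, wexcess 0 C.r (e (t (j + 1))) :=
    Finset.sum_nonneg fun j _ => wexcess_nonneg h0 C.r_nonneg _
  simp only [wexcess_zero_right, wexcess_zero_one, Finset.sum_add_distrib,
    intervalIntegral.integral_zero, Finset.sum_const_zero, add_zero, mul_zero] at h1 ⊢
  linarith

/-- The balance bounds all partial sums of two nonnegative quantities, so both tend to zero; the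
margin `ε` at the jumps provides the second one. -/
theorem IsTraj.loss_tendsto_zero (hh : 0 < h) (ht : IsMinDwell C.T t)
    (he : C.IsTraj h N t (fun _ => 0) (fun _ => 0) ψ e) :
    Tendsto (C.loss 0 h N t (fun _ => 0) (fun _ => 0) ψ e) atTop (𝓝 0) ∧
      Tendsto (fun j => e (t j)) atTop (𝓝 0) := by
  have h0 : |(0 : ℝ)| ≤ 1 := by simp
  have hl : ∀ j, 0 ≤ C.loss 0 h N t (fun _ => 0) (fun _ => 0) ψ e j := fun j =>
    he.loss_nonneg hh ht h0 j (by simp [wexcess_zero_right])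
  have he1 : ∀ j, 0 ≤ C.ε * oneNorm (e (t (j + 1))) := fun j =>
    mul_nonneg C.ε_pos.le (oneNorm_nonneg _)
  have hs := (summable_of_sum_range_le (fun j => add_nonneg (hl j) (he1 j))
    (he.unforced_balance hh ht)).tendsto_atTop_zero
  refine ⟨squeeze_zero hl (fun j => le_add_of_nonneg_right (he1 j)) hs, ?_⟩
  rw [← tendsto_add_atTop_iff_nat 1]
  refine tendsto_pi_nhds.2 fun i => squeeze_zero_norm (a := fun j => C.ε⁻¹ *
    (C.loss 0 h N t (fun _ => 0) (fun _ => 0) ψ e j + C.ε * oneNorm (e (t (j + 1)))))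
    (fun j => ?_) (by simpa using hs.const_mul C.ε⁻¹)
  have := C.ε_pos
  calc ‖e (t (j + 1)) i‖ ≤ oneNorm (e (t (j + 1))) := abs_le_oneNorm _ i
    _ = C.ε⁻¹ * (C.ε * oneNorm (e (t (j + 1)))) := by field_simp
    _ ≤ _ := by gcongr; exact le_add_of_nonneg_left (hl j)

/-- Shortly before the impulses the trajectory is small, eventually. -/
theorem IsTraj.eventually_abs_le (hh : 0 < h) (ht : IsMinDwell C.T t)
    (he : C.IsTraj h N t (fun _ => 0) (fun _ => 0) ψ e) {η : ℝ} (hη : 0 < η) :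
    ∃ K, ∀ k ≥ K, ∀ s ∈ Ioc (t k) (t (k + 1)), t (k + 1) - h ≤ s → ∀ i, |e s i| ≤ η := by
  obtain ⟨hl, hz⟩ := he.loss_tendsto_zero hh ht
  set c := C.α / C.κ
  have hc : 0 ≤ c := div_nonneg C.α_pos.le C.κ_pos.le
  set L := C.loss 0 h N t (fun _ => 0) (fun _ => 0) ψ e with hL
  have hlim : Tendsto (fun k => Real.exp (c * h) * (‖e (t (k + 1))‖ + C.κ⁻¹ * L k)) atTop (𝓝 0) := by
    have h1 : Tendsto (fun k => ‖e (t (k + 1))‖) atTop (𝓝 0) := by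
      simpa using ((tendsto_add_atTop_iff_nat 1).2 hz).norm
    simpa using (h1.add (hl.const_mul C.κ⁻¹)).const_mul (Real.exp (c * h))
  obtain ⟨K, hK⟩ := eventually_atTop.1 (hlim.eventually_le_const hη)
  refine ⟨K, fun k hk s hs hsh i => le_trans ?_ (hK k hk)⟩
  have htk := ht.nonneg C.T_pos k
  have hlt := ht.lt_succ C.T_pos k
  have hmem : t (k + 1) ∈ Ioc (t k) (t (k + 1)) := right_mem_Ioc.2 hlt
  have key := C.exp_mul_abs_le hlt.le (he.integrable k) (C.start N t (fun _ => 0) ψ e k)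
    (he.isFlowRhs k le_rfl)
    (he.intervalIntegrable_delayed hh ht 0 C.U htk (htk.trans hlt.le)) (Ioc_subset_Icc_self hs) i
  rw [he.integral_flow k 0 _ hmem, ← he.eq_flow k hs, lyap, ← he.eq_flow k hmem] at key
  have hLk : wexcess 0 (C.μ 0) (C.start N t (fun _ => 0) ψ e k)
      + (∫ s in t k..t (k + 1), wexcess 0 C.U (e (s - h)))
      - wexcess 0 (C.μ (t (k + 1) - t k)) (e (t (k + 1)))
      - ∫ s in t k..t (k + 1), wexcess 0 C.U (e s) = L k := by
    simp [hL, loss, lyap, wexcess_zero_right]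
  rw [hLk] at key
  have h1 : |e (t (k + 1)) i| ≤ ‖e (t (k + 1))‖ := norm_le_pi_norm (e (t (k + 1))) i
  -- Since `s` lies at most `h` before the next impulse, the exponential factor of the backward
  -- estimate costs at most `exp (c * h)`, however long the dwell-time.
  have h2 : 1 ≤ Real.exp (c * h) * Real.exp (c * (s - t (k + 1))) := by
    rw [← Real.exp_add, Real.one_le_exp_iff, ← mul_add]
    exact mul_nonneg hc (by linarith)
  calc |e s i| ≤ Real.exp (c * h) * Real.exp (c * (s - t (k + 1))) * |e s i| :=
        le_mul_of_one_le_left (abs_nonneg _) h2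
    _ = Real.exp (c * h) * (Real.exp (c * (s - t (k + 1))) * |e s i|) := by ring
    _ ≤ Real.exp (c * h) * (‖e (t (k + 1))‖ + C.κ⁻¹ * L k) := by
        gcongr; linarith

/-- A window of length `h` may contain several impulses. Each of its points precedes the end of its
own dwell interval by at most `h`, so `eventually_abs_le` applies once the window lies beyond `t J`.
-/
theorem IsTraj.window_tendsto_zero (hh : 0 < h) (ht : IsMinDwell C.T t)
    (he : C.IsTraj h N t (fun _ => 0) (fun _ => 0) ψ e) :
    Tendsto (fun k => ∫ s in (t k - h)..t k, wexcess 0 C.U (e s)) atTop (𝓝 0) := by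
  have h0 : |(0 : ℝ)| ≤ 1 := by simp
  have hU : 0 ≤ ∑ j, C.U j := Finset.sum_nonneg fun j _ => C.U_nonneg j
  rw [Metric.tendsto_atTop]
  intro η hη
  -- Chosen so that `h * η' * ∑ j, C.U j < η`; the summand `1` avoids division by zero.
  set η' := η / (2 * (h * (∑ j, C.U j + 1))) with hη'
  have hpos : 0 < 2 * (h * (∑ j, C.U j + 1)) := by positivity
  obtain ⟨J, hJ⟩ := he.eventually_abs_le hh ht (η := η') (by positivity)
  obtain ⟨K, hK⟩ := eventually_atTop.1 ((ht.tendsto C.T_pos).eventually_ge_atTop (t J + h))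
  refine ⟨K, fun k hk => ?_⟩
  have hkJ := hK k hk
  have hbound : ∀ s ∈ Ioc (t k - h) (t k), wexcess 0 C.U (e s) ≤ η' * ∑ j, C.U j := by
    intro s hs
    obtain ⟨l, hl, hsl⟩ := ht.exists_mem_Ioc C.T_pos (J := J) (s := s) (by linarith [hs.1])
    have hlk : l < k := (ht.strictMono C.T_pos).lt_iff_lt.1 (hsl.1.trans_le hs.2)
    have hlk' := (ht.strictMono C.T_pos).monotone (Nat.succ_le_of_lt hlk)
    have hab := hJ l hl s hsl (by simp only [Nat.succ_eq_add_one] at hlk'; linarith [hs.1])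
    rw [Finset.mul_sum]
    refine Finset.sum_le_sum fun j _ => ?_
    rw [mul_comm, excess_zero_left]
    exact mul_le_mul_of_nonneg_right (hab j) (C.U_nonneg j)
  have hnn := integral_wexcess_nonneg (e := e) h0 C.U_nonneg (a := t k - h) (b := t k) (by linarith)
  have htk := ht.nonneg C.T_pos k
  have hle : ∫ s in (t k - h)..t k, wexcess 0 C.U (e s)
      ≤ ∫ _ in (t k - h)..t k, η' * ∑ j, C.U j := by
    refine intervalIntegral.integral_mono_on_of_le_Ioo (by linarith)
      (he.intervalIntegrable_wexcess hh ht 0 _ (by linarith) (by linarith)) (by simp) fun s hs => ?_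
    exact hbound s (Ioo_subset_Ioc_self hs)
  rw [intervalIntegral.integral_const, smul_eq_mul, sub_sub_cancel] at hle
  rw [Real.dist_0_eq_abs, abs_of_nonneg hnn]
  refine hle.trans_lt ?_
  have : η' * (2 * (h * (∑ j, C.U j + 1))) = η := div_mul_cancel₀ _ hpos.ne'
  nlinarith [mul_nonneg hh.le hU, div_pos hη hpos, mul_pos (div_pos hη hpos) hh]

theorem IsTraj.start_tendsto_zero (hh : 0 < h) (ht : IsMinDwell C.T t)
    (he : C.IsTraj h N t (fun _ => 0) (fun _ => 0) ψ e) :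
    Tendsto (fun k => wexcess 0 (C.μ 0) (C.start N t (fun _ => 0) ψ e k)) atTop (𝓝 0) := by
  obtain ⟨-, hz⟩ := he.loss_tendsto_zero hh ht
  have hpast : Tendsto (pastState N t e ψ) atTop (𝓝 0) := by
    refine (hz.comp (tendsto_sub_atTop_nat N)).congr' ?_
    filter_upwards [eventually_ge_atTop N] with k hk
    simp [pastState, hk]
  have hjump : Tendsto (C.jump N t (fun _ => 0) ψ e) atTop (𝓝 0) := by
    have h1 : Continuous fun x : Vec n => C.J *ᵥ x := by fun_prop
    have h2 : Continuous fun x : Vec n => C.H *ᵥ x := by fun_prop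
    have := ((h1.tendsto 0).comp hz).add ((h2.tendsto 0).comp hpast)
    simp only [Matrix.mulVec_zero, add_zero] at this
    refine this.congr fun k => ?_
    simp [jump]
  have := ((continuous_wexcess 0 (C.μ 0)).tendsto 0).comp hjump
  rw [wexcess_zero_right] at this
  refine this.congr' ?_
  filter_upwards [eventually_ge_atTop 1] with k hk
  simp [start, Nat.one_le_iff_ne_zero.1 hk]

/-- The unforced trajectories converge to zero. -/
theorem IsTraj.tendsto_zero (hh : 0 < h) (ht : IsMinDwell C.T t)
    (he : C.IsTraj h N t (fun _ => 0) (fun _ => 0) ψ e) : Tendsto e atTop (𝓝 0) := by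
  have h0 : |(0 : ℝ)| ≤ 1 := by simp
  have hκ := C.κ_pos
  have hlim := (((he.start_tendsto_zero hh ht).add (he.window_tendsto_zero hh ht)).const_mul C.κ⁻¹)
  rw [add_zero, mul_zero] at hlim
  refine Metric.tendsto_atTop.2 fun η hη => ?_
  obtain ⟨K, hK⟩ := eventually_atTop.1 (hlim.eventually_lt_const hη)
  refine ⟨t K + 1, fun s hs => ?_⟩
  obtain ⟨k, hk, hsk⟩ := ht.exists_mem_Ioc C.T_pos (J := K) (s := s) (by linarith)
  have htk := ht.nonneg C.T_pos k
  -- The estimate is restarted at the impulse `k`: the state after the jump and the window before it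
  -- bound the trajectory up to the next impulse.
  have h1 := he.lyap_le hh ht h0 k hsk (by simp [wexcess_zero_right])
  have h2 := he.integral_delayed hh ht 0 C.U htk (htk.trans hsk.1.le)
  have h3 := integral_wexcess_nonneg (e := e) h0 C.U_nonneg (a := s - h) (b := s) (by linarith)
  have h4 := integral_wexcess_nonneg (e := e) h0 C.m_nonneg hsk.1.le
  have h5 := C.mul_oneNorm_le_lyap hsk.1.le e
  simp only [wexcess_zero_right, intervalIntegral.integral_zero, mul_zero, add_zero] at h1
  have h6 : oneNorm (e s) ≤ C.κ⁻¹ * (wexcess 0 (C.μ 0) (C.start N t (fun _ => 0) ψ e k)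
      + ∫ s in (t k - h)..t k, wexcess 0 C.U (e s)) := by
    rw [← div_eq_inv_mul, le_div_iff₀ hκ]
    linarith
  rw [dist_zero_right]
  refine lt_of_le_of_lt ?_ (h6.trans_lt (hK k hk))
  exact (pi_norm_le_iff_of_nonneg (oneNorm_nonneg _)).2 fun i => abs_le_oneNorm _ i

end convergence

end Certificate

end IntervalObs

/-! ### Lyapunov stability, positivity and the hybrid gain. -/

namespace IntervalObs

section initialSize

variable {n : ℕ} {h : ℝ} {e : ℝ → Vec n}

theorem oneNorm_le_initialSize (he : ContinuousOn e (Icc (-h) 0)) (N : ℕ) (ψ : ℕ → Vec n) {s : ℝ}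
    (hs : s ∈ Icc (-h) 0) : oneNorm (e s) ≤ initialSize h N e ψ := by
  have hb : BddAbove ((fun s => oneNorm (e s)) '' Icc (-h) 0) :=
    (isCompact_Icc.image_of_continuousOn (continuous_oneNorm.comp_continuousOn he)).bddAbove
  have h1 : oneNorm (e s) ≤ _ := le_csSup hb ⟨s, hs, rfl⟩
  exact h1.trans (le_add_of_nonneg_right (Finset.sum_nonneg fun j _ => oneNorm_nonneg _))

theorem sum_history_le_initialSize (N : ℕ) (ψ : ℕ → Vec n) :
    ∑ j ∈ Finset.Ico 1 N, oneNorm (ψ j) ≤ initialSize h N e ψ := by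
  refine le_add_of_nonneg_left (Real.sSup_nonneg ?_)
  rintro _ ⟨s, -, rfl⟩
  exact oneNorm_nonneg _

theorem wexcess_le_mul_oneNorm {c : Vec n} (hc : ∀ j, 0 ≤ c j) (x : Vec n) :
    wexcess 0 c x ≤ (∑ j, c j) * oneNorm x := by
  rw [Finset.sum_mul]
  refine Finset.sum_le_sum fun j _ => ?_
  rw [excess_zero_left]
  exact mul_le_mul_of_nonneg_left (abs_le_oneNorm x j) (hc j)

end initialSize

theorem oneNorm_mulVec_le {m n : ℕ} {M : Matrix (Fin m) (Fin n) ℝ} (hM : Nonneg M) (x : Vec n) :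
    oneNorm (M *ᵥ x) ≤ wexcess 0 (1 ᵥ* M) x := by
  have h1 : oneNorm (M *ᵥ x) ≤ ∑ i, ∑ j, M i j * excess 0 (x j) :=
    Finset.sum_le_sum fun i _ => by
      simpa [excess_zero_left] using excess_mulVec_le hM 0 x i
  rw [Finset.sum_comm] at h1
  refine h1.trans_eq (Finset.sum_congr rfl fun j _ => ?_)
  rw [← Finset.sum_mul]
  simp [Matrix.vecMul, dotProduct]

theorem integrableOn_oneNorm {m : ℕ} {w : ℝ → Vec m} {s : Set ℝ} (hw : IntegrableOn w s) :
    IntegrableOn (fun s => oneNorm (w s)) s :=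
  integrable_finsetSum _ fun i _ => (Integrable.eval hw i).abs

theorem normL1_mono {m : ℕ} {w : ℝ → Vec m} {g : ℝ → ℝ} (hg : ∀ s, oneNorm (w s) ≤ g s) :
    normL1 w ≤ ∫⁻ s in Ioi (0 : ℝ), ENNReal.ofReal (g s) :=
  lintegral_mono fun s => ENNReal.ofReal_le_ofReal (hg s)

theorem IsMinDwell.iUnion_Ioc {T : ℝ} (hT : 0 < T) {t : ℕ → ℝ} (ht : IsMinDwell T t) :
    ⋃ k, Ioc (t k) (t (k + 1)) = Ioi 0 := by
  ext s
  simp only [mem_iUnion, mem_Ioi]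
  refine ⟨fun ⟨k, hk⟩ => (ht.nonneg hT k).trans_lt hk.1, fun hs => ?_⟩
  obtain ⟨k, -, hk⟩ := ht.exists_mem_Ioc hT (J := 0) (s := s) (by rwa [ht.1])
  exact ⟨k, hk⟩

namespace Certificate

variable {n pc pd : ℕ} (C : Certificate n pc pd)

/-- A constant that bounds the contribution of the initial condition. -/
noncomputable def initConst (h : ℝ) : ℝ :=
  ∑ j, C.μ 0 j + h * ∑ j, C.U j + 2 * ∑ j, C.q j + 1

theorem initConst_pos {h : ℝ} (hh : 0 < h) : 0 < C.initConst h := by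
  have h1 : 0 ≤ ∑ j, C.μ 0 j := Finset.sum_nonneg fun j _ => C.μ_nonneg le_rfl j
  have h2 : 0 ≤ ∑ j, C.U j := Finset.sum_nonneg fun j _ => C.U_nonneg j
  have h3 : 0 ≤ ∑ j, C.q j := Finset.sum_nonneg fun j _ => C.q_nonneg j
  unfold initConst; positivity

variable {C} {h : ℝ} {N : ℕ} {t : ℕ → ℝ} {δc : ℝ → Vec pc} {δd : ℕ → Vec pd} {ψ : ℕ → Vec n}
  {e : ℝ → Vec n}

theorem IsTraj.initBound_le (hh : 0 < h) (ht : IsMinDwell C.T t)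
    (he : C.IsTraj h N t δc δd ψ e) :
    C.initBound 0 h N ψ e ≤ C.initConst h * initialSize h N e ψ := by
  set s0 := initialSize h N e ψ
  have hnorm : ∀ s ∈ Icc (-h) 0, oneNorm (e s) ≤ s0 := fun s hs =>
    oneNorm_le_initialSize he.init N ψ hs
  have hle : ∀ {c : Vec n}, (∀ j, 0 ≤ c j) → ∀ s ∈ Icc (-h) 0,
      wexcess 0 c (e s) ≤ (∑ j, c j) * s0 := fun hc s hs =>
    (wexcess_le_mul_oneNorm hc _).trans
      (mul_le_mul_of_nonneg_left (hnorm s hs) (Finset.sum_nonneg fun j _ => hc j))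
  have hm0 : (0 : ℝ) ∈ Icc (-h) 0 := ⟨by linarith, le_rfl⟩
  have hs0 : 0 ≤ s0 := (oneNorm_nonneg _).trans (hnorm 0 hm0)
  have h1 := hle (C.μ_nonneg le_rfl) 0 hm0
  have h2 := hle C.q_nonneg 0 hm0
  have h3 : ∫ s in (-h)..0, wexcess 0 C.U (e s) ≤ h * ((∑ j, C.U j) * s0) := by
    have : ∫ s in (-h)..0, wexcess 0 C.U (e s) ≤ ∫ _ in (-h)..0, (∑ j, C.U j) * s0 :=
      intervalIntegral.integral_mono_on (by linarith)
        (he.intervalIntegrable_wexcess hh ht 0 _ le_rfl (by linarith)) (by simp)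
        (hle C.U_nonneg)
    rwa [intervalIntegral.integral_const, smul_eq_mul, sub_neg_eq_add, zero_add] at this
  have h4 : ∑ j ∈ Finset.Ico 1 N, wexcess 0 C.q (ψ j) ≤ (∑ j, C.q j) * s0 := by
    refine (Finset.sum_le_sum fun j _ => wexcess_le_mul_oneNorm C.q_nonneg (ψ j)).trans ?_
    rw [← Finset.mul_sum]
    exact mul_le_mul_of_nonneg_left (sum_history_le_initialSize N ψ)
      (Finset.sum_nonneg fun j _ => C.q_nonneg j)
  unfold initBound initConst
  linarith

/-- Uniform Lyapunov stability of the unforced system. -/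
theorem IsTraj.oneNorm_le (hh : 0 < h) (ht : IsMinDwell C.T t)
    (he : C.IsTraj h N t (fun _ => 0) (fun _ => 0) ψ e) {s : ℝ} (hs : 0 ≤ s) :
    oneNorm (e s) ≤ (1 + C.κ⁻¹ * C.initConst h) * initialSize h N e ψ := by
  have hκ := C.κ_pos
  have hm0 : (0 : ℝ) ∈ Icc (-h) 0 := ⟨by linarith, le_rfl⟩
  have h0 := oneNorm_le_initialSize he.init N ψ hm0
  have hs0 := (oneNorm_nonneg _).trans h0
  have hc := C.initConst_pos hh
  rw [add_mul, one_mul]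
  rcases hs.eq_or_lt with rfl | hs
  · exact h0.trans (le_add_of_nonneg_right (by positivity))
  · obtain ⟨k, -, hk⟩ := ht.exists_mem_Ioc C.T_pos (J := 0) (s := s) (by rwa [ht.1])
    have h1 := he.lyap_le_initBound hh ht (σ := 0) (by simp)
      (fun b _ => by simp [wexcess_zero_right]) k hk
    simp only [wexcess_zero_right, intervalIntegral.integral_zero, Finset.sum_const_zero, add_zero,
      mul_zero] at h1
    have h2 := C.mul_oneNorm_le_lyap hk.1.le e
    have h3 := he.initBound_le hh ht
    refine le_trans ?_ (le_add_of_nonneg_left hs0)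
    rw [mul_assoc, ← div_eq_inv_mul, le_div_iff₀ hκ]
    linarith

/-- Trajectories with nonnegative initial conditions and inputs are nonnegative. -/
theorem IsTraj.nonneg (hh : 0 < h) (ht : IsMinDwell C.T t) (he : C.IsTraj h N t δc δd ψ e)
    (hδc : ∀ s, 0 ≤ s → 0 ≤ δc s) (hδd : ∀ k, 0 ≤ δd k) (hψ : ∀ j, 0 ≤ ψ j)
    (he0 : ∀ s ∈ Icc (-h) 0, 0 ≤ e s) {s : ℝ} (hs : 0 ≤ s) : 0 ≤ e s := by
  have hz : ∀ {m : ℕ} (c : Vec m) {x : Vec m}, 0 ≤ x → wexcess 1 c x = 0 := fun c x hx =>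
    Finset.sum_eq_zero fun j _ => by rw [excess_one_eq_zero.2 (hx j), mul_zero]
  have hm0 : (0 : ℝ) ∈ Icc (-h) 0 := ⟨by linarith, le_rfl⟩
  rcases hs.eq_or_lt with rfl | hs
  · exact he0 0 hm0
  obtain ⟨k, -, hk⟩ := ht.exists_mem_Ioc C.T_pos (J := 0) (s := s) (by rwa [ht.1])
  -- For nonnegative inputs the excess with `σ = 1` vanishes, so it is integrable without any
  -- assumption on `δc`.
  have hδ : ∀ b, 0 ≤ b → EqOn (fun _ => (0 : ℝ)) (fun s => wexcess 1 1 (δc s)) (uIoc 0 b) := by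
    intro b hb r hr
    rw [uIoc_of_le hb] at hr
    exact (hz 1 (hδc r hr.1.le)).symm
  have hint : ∀ b, 0 ≤ b → IntervalIntegrable (fun s => wexcess 1 1 (δc s)) volume 0 b :=
    fun b hb => (intervalIntegrable_const (c := (0 : ℝ))).congr (hδ b hb)
  have h1 := he.lyap_le_initBound hh ht (σ := 1) (by simp) hint k hk
  have h2 : ∫ r in (0 : ℝ)..s, wexcess 1 1 (δc r) = 0 := by
    refine (intervalIntegral.integral_congr_ae (Eventually.of_forall fun r hr => ?_)).trans
      intervalIntegral.integral_zero
    exact (hδ s hs.le hr).symm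
  have h3 : ∫ r in (-h)..0, wexcess 1 C.U (e r) = 0 := by
    refine (intervalIntegral.integral_congr fun r hr => ?_).trans intervalIntegral.integral_zero
    rw [uIcc_of_le (by linarith)] at hr
    exact hz _ (he0 r hr)
  have h4 : C.initBound 1 h N ψ e = 0 := by
    rw [initBound, h3, hz _ (he0 0 hm0), hz _ (he0 0 hm0),
      Finset.sum_eq_zero fun j _ => hz C.q (hψ j)]
    simp
  rw [h4, h2, Finset.sum_eq_zero fun j _ => hz 1 (hδd (j + 1))] at h1
  simp only [add_zero, mul_zero] at h1
  intro i
  have hτ : 0 ≤ s - t k := by linarith [hk.1]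
  have h5 : C.μ (s - t k) i * excess 1 (e s i) ≤ C.lyap 1 (t k) e s :=
    Finset.single_le_sum (f := fun i => C.μ (s - t k) i * excess 1 (e s i))
      (fun j _ => mul_nonneg (C.μ_nonneg hτ j) (excess_nonneg (by simp) _)) (Finset.mem_univ i)
  have h6 : 0 < C.μ (s - t k) i := C.κ_pos.trans_le (C.κ_le _ hτ i)
  have h7 := excess_nonneg (σ := 1) (by simp) (e s i)
  exact excess_one_eq_zero.1 (le_antisymm (by nlinarith) h7)

/-- The hybrid `L₁/ℓ₁`-gain estimate. -/
theorem IsTraj.gain_le (hh : 0 < h) (ht : IsMinDwell C.T t) (he : C.IsTraj h N t δc δd ψ e)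
    (hδc : IntegrableOn δc (Ioi 0)) :
    (∫⁻ s in Ioi (0 : ℝ), ENNReal.ofReal (wexcess 0 C.m (e s)))
        + ∑' k, ENNReal.ofReal (wexcess 0 C.r (e (t (k + 1))))
      ≤ ENNReal.ofReal C.γ * (normL1 δc + norml1 δd)
        + ENNReal.ofReal (C.initConst h * initialSize h N e ψ) := by
  have h0 : |(0 : ℝ)| ≤ 1 := by simp
  have hdisj : Pairwise (Function.onFun Disjoint fun k => Ioc (t k) (t (k + 1))) :=
    (ht.strictMono C.T_pos).monotone.pairwise_disjoint_on_Ioc_succ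
  have hnn := ht.nonneg C.T_pos
  have hδ : ∀ b, 0 ≤ b → IntervalIntegrable (fun s => oneNorm (δc s)) volume 0 b := fun b hb => by
    rw [intervalIntegrable_iff, uIoc_of_le hb]
    exact (integrableOn_oneNorm hδc).mono_set Ioc_subset_Ioi_self
  have hw : ∀ b, 0 ≤ b → IntervalIntegrable (fun s => wexcess 0 1 (δc s)) volume 0 b := by
    simpa only [wexcess_zero_one] using hδ
  have hpiece : ∀ k, ∫⁻ s in Ioc (t k) (t (k + 1)), ENNReal.ofReal (wexcess 0 C.m (e s))
      = ENNReal.ofReal (∫ s in t k..t (k + 1), wexcess 0 C.m (e s)) := fun k => by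
    have hlt := (ht.lt_succ C.T_pos k).le
    rw [intervalIntegral.integral_of_le hlt]
    refine (ofReal_integral_eq_lintegral_ofReal ?_ ?_).symm
    · have := he.intervalIntegrable_wexcess hh ht 0 C.m (a := t k) (b := t (k + 1))
        (by linarith [hnn k]) (by linarith [hnn (k + 1)])
      rwa [intervalIntegrable_iff, uIoc_of_le hlt] at this
    · exact Eventually.of_forall fun s => wexcess_nonneg h0 C.m_nonneg _
  -- Both outputs become one series over the dwell intervals, whose partial sums are bounded by the
  -- balance.
  rw [← ht.iUnion_Ioc C.T_pos, lintegral_iUnion (fun k => measurableSet_Ioc) hdisj,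
    ← ENNReal.tsum_add]
  refine ENNReal.tsum_le_of_sum_range_le fun k => ?_
  have hI : ∀ j, 0 ≤ ∫ s in t j..t (j + 1), wexcess 0 C.m (e s) := fun j =>
    integral_wexcess_nonneg h0 C.m_nonneg (ht.lt_succ C.T_pos j).le
  have hr : ∀ j, 0 ≤ wexcess 0 C.r (e (t (j + 1))) := fun j => wexcess_nonneg h0 C.r_nonneg _
  have hsum : ∑ j ∈ Finset.range k, ((∫⁻ s in Ioc (t j) (t (j + 1)),
      ENNReal.ofReal (wexcess 0 C.m (e s))) + ENNReal.ofReal (wexcess 0 C.r (e (t (j + 1)))))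
      = ENNReal.ofReal (∑ j ∈ Finset.range k, ((∫ s in t j..t (j + 1), wexcess 0 C.m (e s))
        + wexcess 0 C.r (e (t (j + 1))))) := by
    rw [ENNReal.ofReal_sum_of_nonneg fun j _ => add_nonneg (hI j) (hr j)]
    refine Finset.sum_congr rfl fun j _ => ?_
    rw [hpiece, ENNReal.ofReal_add (hI j) (hr j)]
  rw [hsum]
  have hbal := he.balance hh ht h0 hw k
  have hle : ∑ j ∈ Finset.range k, ((∫ s in t j..t (j + 1), wexcess 0 C.m (e s))
        + wexcess 0 C.r (e (t (j + 1))))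
      ≤ ∑ j ∈ Finset.range k, (C.loss 0 h N t δc δd ψ e j + C.ε * wexcess 0 1 (e (t (j + 1)))
        + wexcess 0 C.r (e (t (j + 1)))) := by
    refine Finset.sum_le_sum fun j _ => ?_
    have e1 := he.integral_le_loss hh ht h0 j ((hw _ (hnn j)).symm.trans (hw _ (hnn (j + 1))))
    have e2 := mul_nonneg C.ε_pos.le (wexcess_nonneg h0 (c := 1) (by simp) (e (t (j + 1))))
    linarith
  have h1 := wexcess_nonneg h0 (C.μ_nonneg le_rfl) (C.start N t δd ψ e k)
  have h2 := integral_wexcess_nonneg (e := e) h0 C.U_nonneg (a := t k - h) (b := t k) (by linarith)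
  have h3 := he.initBound_le hh ht
  simp only [wexcess_zero_one] at hbal
  have hγ := C.γ_pos.le
  have hA : 0 ≤ ∫ s in 0..t k, oneNorm (δc s) :=
    intervalIntegral.integral_nonneg (hnn k) fun s _ => oneNorm_nonneg _
  have hB : 0 ≤ ∑ j ∈ Finset.range k, oneNorm (δd (j + 1)) :=
    Finset.sum_nonneg fun j _ => oneNorm_nonneg _
  have hA' : ENNReal.ofReal (∫ s in 0..t k, oneNorm (δc s)) ≤ normL1 δc := by
    rw [intervalIntegral.integral_of_le (hnn k), ofReal_integral_eq_lintegral_ofReal]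
    · exact lintegral_mono_set Ioc_subset_Ioi_self
    · exact (integrableOn_oneNorm hδc).mono_set Ioc_subset_Ioi_self
    · exact Eventually.of_forall fun s => oneNorm_nonneg _
  have hB' : ENNReal.ofReal (∑ j ∈ Finset.range k, oneNorm (δd (j + 1))) ≤ norml1 δd := by
    rw [ENNReal.ofReal_sum_of_nonneg fun j _ => oneNorm_nonneg _]
    exact ENNReal.sum_le_tsum _
  calc _ ≤ ENNReal.ofReal (C.γ * ((∫ s in 0..t k, oneNorm (δc s))
        + ∑ j ∈ Finset.range k, oneNorm (δd (j + 1))) + C.initConst h * initialSize h N e ψ) :=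
        ENNReal.ofReal_le_ofReal (by simp only [wexcess_zero_one] at hle; linarith)
    _ ≤ ENNReal.ofReal (C.γ * ((∫ s in 0..t k, oneNorm (δc s))
        + ∑ j ∈ Finset.range k, oneNorm (δd (j + 1))))
        + ENNReal.ofReal (C.initConst h * initialSize h N e ψ) := ENNReal.ofReal_add_le
    _ ≤ _ := by
        rw [ENNReal.ofReal_mul hγ, ENNReal.ofReal_add hA hB]
        gcongr

end Certificate

end IntervalObs

/-! ### From the linear program to a certificate. -/

namespace IntervalObs

theorem timerGain_eq {n r : ℕ} (L : ℝ → Matrix (Fin n) (Fin r) ℝ) (T τ : ℝ) :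
    timerGain L T τ = L (min τ T) := by
  unfold timerGain
  split_ifs with h
  · rw [min_eq_left h]
  · rw [min_eq_right (not_le.1 h).le]

theorem IsDiag_mul_apply {n k : ℕ} {X : Matrix (Fin n) (Fin n) ℝ} (hX : X.IsDiag)
    (M : Matrix (Fin n) (Fin k) ℝ) (i : Fin n) (j : Fin k) : (X * M) i j = X i i * M i j := by
  rw [Matrix.mul_apply, Finset.sum_eq_single i (fun l _ hl => by rw [hX hl.symm, zero_mul])
    (by simp)]

/-- This undoes the change of variables `Y = X L`. As `X` is diagonal, each entry is merely scaled
by `X i i`, so for positive `X i i` signs carry over entrywise. -/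
theorem diag_mul_sub_inv_mul_apply {n r k : ℕ} {X : Matrix (Fin n) (Fin n) ℝ} (hX : X.IsDiag)
    (hu : IsUnit X) (A : Matrix (Fin n) (Fin k) ℝ) (Y : Matrix (Fin n) (Fin r) ℝ)
    (C : Matrix (Fin r) (Fin k) ℝ) (i : Fin n) (j : Fin k) :
    X i i * (A - X⁻¹ * Y * C) i j = (X * A - Y * C) i j := by
  rw [← IsDiag_mul_apply hX, Matrix.mul_sub, Matrix.mul_assoc, Matrix.mul_nonsing_inv_cancel_left]
  exact (Matrix.isUnit_iff_isUnit_det X).1 hu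

theorem IsDiag_ne_zero {n : ℕ} {X : Matrix (Fin n) (Fin n) ℝ} (hX : X.IsDiag) (hu : IsUnit X)
    (i : Fin n) : X i i ≠ 0 := by
  intro h
  have h1 := ((Matrix.isUnit_iff_isUnit_det X).1 hu).ne_zero
  rw [← hX.diagonal_diag, Matrix.det_diagonal] at h1
  exact h1 (Finset.prod_eq_zero (Finset.mem_univ i) h)

theorem IsDiag_sum_col {n : ℕ} {X : Matrix (Fin n) (Fin n) ℝ} (hX : X.IsDiag) (j : Fin n) :
    ∑ i, X i j = X j j :=
  Finset.sum_eq_single j (fun _ _ hl => hX hl) (by simp)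

theorem one_vecMul_apply {m k : ℕ} (M : Matrix (Fin m) (Fin k) ℝ) (j : Fin k) :
    ((1 : Vec m) ᵥ* M) j = ∑ i, M i j := by
  simp [Matrix.vecMul, dotProduct]

theorem exists_pos_le {n : ℕ} {f : ℝ → Vec n} {T : ℝ} (hT : 0 ≤ T)
    (hf : ∀ i, ContinuousOn (fun τ => f τ i) (Icc 0 T)) (hpos : ∀ τ ∈ Icc 0 T, ∀ i, 0 < f τ i) :
    ∃ κ > 0, ∀ τ ∈ Icc 0 T, ∀ i, κ ≤ f τ i := by
  have h1 : ∀ i, ∃ τ ∈ Icc 0 T, IsMinOn (fun τ => f τ i) (Icc 0 T) τ := fun i =>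
    isCompact_Icc.exists_isMinOn ⟨0, left_mem_Icc.2 hT⟩ (hf i)
  choose s hs hmin using h1
  cases isEmpty_or_nonempty (Fin n) with
  | inl h => exact ⟨1, one_pos, fun _ _ i => h.elim i⟩
  | inr h =>
    obtain ⟨i0, hi0⟩ := Finite.exists_min fun i => f (s i) i
    exact ⟨f (s i0) i0, hpos _ (hs i0) i0, fun τ hτ i => (hi0 i).trans (hmin i hτ)⟩

/-- A function that never vanishes and is positive at `0` stays positive. -/
theorem pos_of_ne_zero {f : ℝ → ℝ} {T : ℝ} (hf : ContinuousOn f (Icc 0 T)) (h0 : 0 < f 0)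
    (hne : ∀ τ ∈ Icc 0 T, f τ ≠ 0) {τ : ℝ} (hτ : τ ∈ Icc 0 T) : 0 < f τ := by
  by_contra! h
  obtain ⟨s, hs, hs0⟩ := intermediate_value_Icc' hτ.1 (hf.mono (Icc_subset_Icc_right hτ.2))
    (show (0 : ℝ) ∈ Icc (f τ) (f 0) from ⟨h, h0.le⟩)
  exact hne s ⟨hs.1, hs.2.trans hτ.2⟩ hs0

section frozen

variable {f f' : ℝ → ℝ} {T : ℝ}

/-- The derivative of a function that is frozen at time `T`. -/
theorem hasDerivAt_comp_min (hf : ∀ τ ∈ Icc 0 T, HasDerivWithinAt f (f' τ) (Icc 0 T) τ) {τ : ℝ}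
    (hτ : 0 < τ) (hτT : τ ≠ T) :
    HasDerivAt (fun s => f (min s T)) (if τ < T then f' τ else 0) τ := by
  rcases lt_or_gt_of_ne hτT with h | h
  · rw [if_pos h]
    refine ((hf τ ⟨hτ.le, h.le⟩).hasDerivAt (Icc_mem_nhds hτ h)).congr_of_eventuallyEq ?_
    filter_upwards [Iio_mem_nhds h] with s hs
    rw [min_eq_left (le_of_lt hs)]
  · rw [if_neg h.le.not_gt]
    refine (hasDerivAt_const τ (f T)).congr_of_eventuallyEq ?_
    filter_upwards [Ioi_mem_nhds h] with s hs
    rw [min_eq_right (le_of_lt hs)]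

/-- A differentiable function need not be absolutely continuous; the upper bound on `f'` makes `f'`
integrable. Beyond `T` the function is constant, and the kink at `T` is a single exceptional point.
-/
theorem ac_comp_min (hT : 0 < T) (hf : ∀ τ ∈ Icc 0 T, HasDerivWithinAt f (f' τ) (Icc 0 T) τ)
    {c : ℝ} (hc : ∀ τ ∈ Icc 0 T, f' τ ≤ c) {b : ℝ} (hb : 0 ≤ b) :
    AbsolutelyContinuousOnInterval (fun τ => f (min τ T)) 0 b := by
  have hcont : ContinuousOn f (Icc 0 T) := fun s hs => (hf s hs).continuousWithinAt
  have hmap : MapsTo (fun τ => min τ T) (Icc 0 (max b T)) (Icc 0 T) := fun τ hτ =>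
    ⟨le_min hτ.1 hT.le, min_le_right _ _⟩
  have hi1 : IntervalIntegrable f' volume 0 T := intervalIntegrable_of_deriv_le hT.le hcont
    (fun s hs => (hf s (Ioo_subset_Icc_self hs)).hasDerivAt (Icc_mem_nhds hs.1 hs.2))
    (fun s hs => hc s (Ioo_subset_Icc_self hs))
  have hi2 : IntervalIntegrable (fun τ => if τ < T then f' τ else 0) volume 0 T := by
    refine hi1.congr_ae ?_
    have hne : ∀ᵐ s : ℝ, s ≠ T := by simp [ae_iff, measure_singleton]
    rw [EventuallyEq, uIoc_of_le hT.le, ae_restrict_iff' measurableSet_Ioc]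
    filter_upwards [hne] with s hs hsm
    rw [if_pos (lt_of_le_of_ne hsm.2 hs)]
  have hi3 : IntervalIntegrable (fun τ => if τ < T then f' τ else 0) volume T (max b T) := by
    refine (intervalIntegrable_const (c := (0 : ℝ))).congr fun s hs => ?_
    rw [uIoc_of_le (le_max_right _ _)] at hs
    exact (if_neg hs.1.le.not_gt).symm
  have hbT : (0 : ℝ) ≤ max b T := hb.trans (le_max_left _ _)
  refine (AbsolutelyContinuousOnInterval.of_hasDerivAt_off_countable hbT (countable_singleton T)
    (hcont.comp (by fun_prop) hmap) (fun τ hτ => hasDerivAt_comp_min hf hτ.1.1 hτ.2)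
    (hi2.trans hi3)).mono ?_
  rw [uIcc_of_le hb, uIcc_of_le hbT]
  exact Icc_subset_Icc_right (le_max_left _ _)

end frozen

/-- The linear program of the observer design provides a certificate for the error dynamics. -/
theorem exists_certificate {n pc pd rc rd : ℕ} (S : System n pc pd rc rd)
    (Mc Md : Matrix (Fin n) (Fin n) ℝ) (hMc : Nonneg Mc) (hMd : Nonneg Md)
    (Tbar : ℝ) (hTbar : 0 < Tbar) (X dX : ℝ → Matrix (Fin n) (Fin n) ℝ)
    (hXdiag : ∀ τ ∈ Icc 0 Tbar, (X τ).IsDiag)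
    (hXderiv : ∀ τ ∈ Icc 0 Tbar, ∀ i j,
      HasDerivWithinAt (fun s => X s i j) (dX τ i j) (Icc 0 Tbar) τ)
    (hXinv : ∀ τ ∈ Icc 0 Tbar, IsUnit (X τ)) (hXpos : ∀ τ ∈ Icc 0 Tbar, ∀ i, 0 < X τ i i)
    (Yc : ℝ → Matrix (Fin n) (Fin rc) ℝ) (Yd : Matrix (Fin n) (Fin rd) ℝ)
    (Uc : Matrix (Fin n) (Fin n) ℝ) (hUdiag : Uc.IsDiag) (hUpos : ∀ i, 0 ≤ Uc i i)
    (ε α γ : ℝ) (hε : 0 < ε) (hα : 0 < α) (hγ : 0 < γ)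
    (hA : ∀ τ ∈ Icc 0 Tbar, Nonneg
      (X τ * S.A - Yc τ * S.Cyc + α • (1 : Matrix (Fin n) (Fin n) ℝ)))
    (hGc : ∀ τ ∈ Icc 0 Tbar, Nonneg (X τ * S.Gc - Yc τ * S.Hyc))
    (hEc : ∀ τ ∈ Icc 0 Tbar, Nonneg (X τ * S.Ec - Yc τ * S.Fyc))
    (hJ : Nonneg (X 0 * S.J - Yd * S.Cyd)) (hGd : Nonneg (X 0 * S.Gd - Yd * S.Hyd))
    (hEd : Nonneg (X 0 * S.Ed - Yd * S.Fyd))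
    (hT1 : 1 ᵥ* (X Tbar * S.A - Yc Tbar * S.Cyc + Uc) + 1 ᵥ* Mc ≤ 0)
    (hC1 : ∀ τ ∈ Icc 0 Tbar,
      1 ᵥ* (dX τ + X τ * S.A - Yc τ * S.Cyc + Uc) + 1 ᵥ* Mc ≤ 0)
    (hC2 : ∀ τ ∈ Icc 0 Tbar, 1 ᵥ* (X τ * S.Gc - Yc τ * S.Hyc - Uc) ≤ 0)
    (hC3 : ∀ τ ∈ Icc 0 Tbar, 1 ᵥ* (X τ * S.Ec - Yc τ * S.Fyc) - γ • 1 ≤ 0)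
    (hD1 : 1 ᵥ* (X 0 * (S.J + S.Gd) - Yd * (S.Cyd + S.Hyd) - X Tbar
      + ε • (1 : Matrix (Fin n) (Fin n) ℝ)) + 1 ᵥ* Md ≤ 0)
    (hD2 : 1 ᵥ* (X 0 * S.Ed - Yd * S.Fyd) - γ • 1 ≤ 0) :
    ∃ C : Certificate n pc pd, C.T = Tbar ∧ C.γ = γ ∧ C.m = 1 ᵥ* Mc ∧ C.r = 1 ᵥ* Md ∧
      (∀ h N t δc δd ψ e, h = S.hc → N = S.hd →
        IsErrorTrajectory S Tbar (fun τ => (X τ)⁻¹ * Yc τ) ((X 0)⁻¹ * Yd) t δc δd ψ e →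
        C.IsTraj h N t δc δd ψ e) := by
  have hm0 : (0 : ℝ) ∈ Icc 0 Tbar := left_mem_Icc.2 hTbar.le
  have hmT : Tbar ∈ Icc 0 Tbar := right_mem_Icc.2 hTbar.le
  have hmin : ∀ τ, 0 ≤ τ → min τ Tbar ∈ Icc 0 Tbar := fun τ hτ =>
    ⟨le_min hτ hTbar.le, min_le_right _ _⟩
  have hcont : ∀ i, ContinuousOn (fun τ => X τ i i) (Icc 0 Tbar) := fun i s hs =>
    (hXderiv s hs i i).continuousWithinAt
  -- Off-diagonal entries of `X` vanish on the whole interval, so their derivatives do too, by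
  -- uniqueness.
  have hdXdiag : ∀ τ ∈ Icc 0 Tbar, (dX τ).IsDiag := fun τ hτ i j hij =>
    (uniqueDiffOn_Icc hTbar τ hτ).eq_deriv _ (hXderiv τ hτ i j)
      ((hasDerivWithinAt_const τ (Icc 0 Tbar) (0 : ℝ)).congr (fun s hs => hXdiag s hs hij)
        (hXdiag τ hτ hij))
  have hoff : ∀ τ ∈ Icc 0 Tbar, ∀ i j, i ≠ j → 0 ≤ (X τ * S.A - Yc τ * S.Cyc) i j := by
    intro τ hτ i j hij
    simpa [Matrix.one_apply_ne hij] using hA τ hτ i j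
  have hdiag : ∀ τ ∈ Icc 0 Tbar, ∀ i, -α ≤ (X τ * S.A - Yc τ * S.Cyc) i i := by
    intro τ hτ i
    have := hA τ hτ i i
    rw [Matrix.add_apply, Matrix.smul_apply, Matrix.one_apply_eq, smul_eq_mul, mul_one] at this
    linarith
  have hm : ∀ j, 0 ≤ ((1 : Vec n) ᵥ* Mc) j := fun j => by
    rw [one_vecMul_apply]; exact Finset.sum_nonneg fun i _ => hMc i j
  have hr : ∀ j, 0 ≤ ((1 : Vec n) ᵥ* Md) j := fun j => by
    rw [one_vecMul_apply]; exact Finset.sum_nonneg fun i _ => hMd i j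
  have hcol : ∀ τ ∈ Icc 0 Tbar, ∀ j, dX τ j j + ∑ i, (X τ * S.A - Yc τ * S.Cyc) i j + Uc j j
      + ((1 : Vec n) ᵥ* Mc) j ≤ 0 := by
    intro τ hτ j
    have := hC1 τ hτ j
    rw [Pi.add_apply, one_vecMul_apply] at this
    simp only [add_sub_assoc, Matrix.add_apply _ _ _ j, Finset.sum_add_distrib,
      IsDiag_sum_col (hdXdiag τ hτ), IsDiag_sum_col hUdiag] at this
    exact this
  have hcolT : ∀ j, ∑ i, (X Tbar * S.A - Yc Tbar * S.Cyc) i j + Uc j j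
      + ((1 : Vec n) ᵥ* Mc) j ≤ 0 := by
    intro j
    have := hT1 j
    rw [Pi.add_apply, one_vecMul_apply] at this
    simp only [Matrix.add_apply _ _ _ j, Finset.sum_add_distrib, IsDiag_sum_col hUdiag] at this
    exact this
  -- The column sums of `X A - Yc Cyc` are at least `-α`, because only the diagonal entry can be
  -- negative. The column condition then bounds `X'` from above.
  have hdle : ∀ j, ∀ τ ∈ Icc 0 Tbar, dX τ j j ≤ α := by
    intro j τ hτ
    have h1 := hcol τ hτ j
    have h2 : -α ≤ ∑ i, (X τ * S.A - Yc τ * S.Cyc) i j := by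
      rw [← Finset.add_sum_erase _ _ (Finset.mem_univ j)]
      have := Finset.sum_nonneg (s := Finset.univ.erase j)
        (f := fun i => (X τ * S.A - Yc τ * S.Cyc) i j)
        fun i hi => hoff τ hτ i j (Finset.ne_of_mem_erase hi)
      linarith [hdiag τ hτ j]
    linarith [hUpos j, hm j]
  obtain ⟨κ, hκ, hκle⟩ := exists_pos_le (f := fun τ i => X τ i i) hTbar.le hcont hXpos
  have hB : ∀ τ ∈ Icc 0 Tbar, ∀ {k : ℕ} (A : Matrix (Fin n) (Fin k) ℝ)
      (P : Matrix (Fin rc) (Fin k) ℝ) i j,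
      X τ i i * (A - (X τ)⁻¹ * Yc τ * P) i j = (X τ * A - Yc τ * P) i j := fun τ hτ _ A P i j =>
    diag_mul_sub_inv_mul_apply (hXdiag τ hτ) (hXinv τ hτ) _ _ _ _ _
  have hB0 : ∀ {k : ℕ} (A : Matrix (Fin n) (Fin k) ℝ) (P : Matrix (Fin rd) (Fin k) ℝ) i j,
      X 0 i i * (A - (X 0)⁻¹ * Yd * P) i j = (X 0 * A - Yd * P) i j := fun A P i j =>
    diag_mul_sub_inv_mul_apply (hXdiag 0 hm0) (hXinv 0 hm0) _ _ _ _ _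
  have hpos : ∀ τ ∈ Icc 0 Tbar, ∀ i {x : ℝ}, 0 ≤ X τ i i * x → 0 ≤ x := fun τ hτ i x hx =>
    (mul_nonneg_iff_of_pos_left (hXpos τ hτ i)).1 hx
  have h0min : min 0 Tbar = 0 := min_eq_left hTbar.le
  refine ⟨{
    T := Tbar
    T_pos := hTbar
    B := fun τ => S.A - timerGain (fun τ => (X τ)⁻¹ * Yc τ) Tbar τ * S.Cyc
    G := fun τ => S.Gc - timerGain (fun τ => (X τ)⁻¹ * Yc τ) Tbar τ * S.Hyc
    E := fun τ => S.Ec - timerGain (fun τ => (X τ)⁻¹ * Yc τ) Tbar τ * S.Fyc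
    J := S.J - (X 0)⁻¹ * Yd * S.Cyd
    H := S.Gd - (X 0)⁻¹ * Yd * S.Hyd
    F := S.Ed - (X 0)⁻¹ * Yd * S.Fyd
    μ := fun τ i => X (min τ Tbar) i i
    dμ := fun τ i => if τ < Tbar then dX τ i i else 0
    U := fun j => Uc j j
    m := 1 ᵥ* Mc
    r := 1 ᵥ* Md
    α := α
    κ := κ
    γ := γ
    ε := ε
    α_pos := hα
    κ_pos := hκ
    γ_pos := hγ
    ε_pos := hε
    U_nonneg := hUpos
    m_nonneg := hm
    r_nonneg := hr
    metzler := fun τ hτ i j hij => hpos _ (hmin τ hτ.le) i (by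
      rw [timerGain_eq, hB _ (hmin τ hτ.le)]; exact hoff _ (hmin τ hτ.le) i j hij)
    G_nonneg := fun τ hτ i j => hpos _ (hmin τ hτ.le) i (by
      rw [timerGain_eq, hB _ (hmin τ hτ.le)]; exact hGc _ (hmin τ hτ.le) i j)
    E_nonneg := fun τ hτ i j => hpos _ (hmin τ hτ.le) i (by
      rw [timerGain_eq, hB _ (hmin τ hτ.le)]; exact hEc _ (hmin τ hτ.le) i j)
    J_nonneg := fun i j => hpos 0 hm0 i (by rw [hB0]; exact hJ i j)
    H_nonneg := fun i j => hpos 0 hm0 i (by rw [hB0]; exact hGd i j)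
    F_nonneg := fun i j => hpos 0 hm0 i (by rw [hB0]; exact hEd i j)
    κ_le := fun τ hτ i => hκle _ (hmin τ hτ) i
    μ_ac := fun b hb i => ac_comp_min (f := fun τ => X τ i i) hTbar
      (fun τ hτ => hXderiv τ hτ i i) (hdle i) hb
    μ_deriv := fun τ hτ hτT i => hasDerivAt_comp_min (f := fun τ => X τ i i)
      (f' := fun τ => dX τ i i) (fun τ hτ => hXderiv τ hτ i i) hτ hτT
    μ_const := fun τ hτ => by simp only [min_eq_right hτ, min_self]
    diag_ge := fun τ hτ i => by
      rw [timerGain_eq, hB _ (hmin τ hτ.le)]; exact hdiag _ (hmin τ hτ.le) i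
    col_B := fun τ hτ j => ?_
    col_G := fun τ hτ j => ?_
    col_E := fun τ hτ j => ?_
    col_J := fun j => ?_
    col_F := fun j => ?_ }, rfl, rfl, rfl, rfl, ?_⟩
  · simp only [timerGain_eq, hB _ (hmin τ hτ.le)]
    -- Before `Tbar` the condition with `dX` applies. Afterwards weights and gains are frozen, and
    -- the condition at `Tbar` without derivative takes over.
    split_ifs with h
    · rw [min_eq_left h.le]
      exact hcol τ ⟨hτ.le, h.le⟩ j
    · rw [min_eq_right (not_lt.1 h), zero_add]
      exact hcolT j
  · simp only [timerGain_eq, hB _ (hmin τ hτ.le)]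
    have := hC2 _ (hmin τ hτ.le) j
    rw [one_vecMul_apply] at this
    simp only [Matrix.sub_apply _ Uc _ j, Finset.sum_sub_distrib, IsDiag_sum_col hUdiag] at this
    exact sub_nonpos.1 this
  · simp only [timerGain_eq, hB _ (hmin τ hτ.le)]
    have := hC3 _ (hmin τ hτ.le) j
    rw [Pi.sub_apply, one_vecMul_apply] at this
    simpa using this
  · simp only [h0min, min_self, hB0]
    have := hD1 j
    rw [Pi.add_apply, one_vecMul_apply] at this
    have e1 : X 0 * (S.J + S.Gd) - Yd * (S.Cyd + S.Hyd) - X Tbar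
        + ε • (1 : Matrix (Fin n) (Fin n) ℝ) = (X 0 * S.J - Yd * S.Cyd) + (X 0 * S.Gd - Yd * S.Hyd)
        - X Tbar + ε • (1 : Matrix (Fin n) (Fin n) ℝ) := by
      rw [Matrix.mul_add, Matrix.mul_add]; abel
    rw [e1] at this
    have e2 : ∑ i, (ε • (1 : Matrix (Fin n) (Fin n) ℝ)) i j = ε := by
      rw [IsDiag_sum_col (Matrix.isDiag_one.smul ε)]; simp
    have e3 : ∑ i, ((X 0 * S.J - Yd * S.Cyd) + (X 0 * S.Gd - Yd * S.Hyd)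
        - X Tbar + ε • (1 : Matrix (Fin n) (Fin n) ℝ)) i j = ∑ i, (X 0 * S.J - Yd * S.Cyd) i j
        + ∑ i, (X 0 * S.Gd - Yd * S.Hyd) i j - X Tbar j j + ε := by
      refine Eq.trans ?_ (congrArg _ e2)
      rw [← IsDiag_sum_col (hXdiag Tbar hmT) j, ← Finset.sum_add_distrib,
        ← Finset.sum_sub_distrib, ← Finset.sum_add_distrib]
      rfl
    rw [e3] at this
    have e4 : (0 : Vec n) j = 0 := rfl
    rw [e4] at this
    linarith
  · simp only [h0min, hB0]
    have := hD2 j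
    rw [Pi.sub_apply, one_vecMul_apply] at this
    simpa using this
  · rintro h N t δc δd ψ e rfl rfl he
    exact he

/-! ### Observer errors as trajectories of the error dynamics. -/

section errors

variable {n pc pd rc rd : ℕ} {S : System n pc pd rc rd} {Tbar : ℝ}
  {L : ℝ → Matrix (Fin n) (Fin rc) ℝ} {Ld : Matrix (Fin n) (Fin rd) ℝ} {t : ℕ → ℝ}

theorem IsTrajectory.sub {h : ℝ} {x y : ℝ → Vec n} {f f' : ℕ → ℝ → Vec n} {g g' : ℕ → Vec n}
    (hT : ∀ k, t k ≤ t (k + 1))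
    (hx : IsTrajectory h t x f g) (hy : IsTrajectory h t y f' g') :
    IsTrajectory h t (x - y) (fun k r => f k r - f' k r) (fun k => g k - g' k) where
  init := hx.init.sub hy.init
  integrable k := (hx.integrable k).sub (hy.integrable k)
  flow k s hs := by
    have hsub : uIcc (t k) s ⊆ uIcc (t k) (t (k + 1)) :=
      uIcc_subset_uIcc_left (by rw [uIcc_of_le (hT k)]; exact Ioc_subset_Icc_self hs)
    rw [Pi.sub_apply, hx.flow k s hs, hy.flow k s hs,
      intervalIntegral.integral_sub ((hx.integrable k).mono_set hsub)
        ((hy.integrable k).mono_set hsub)]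
    split_ifs
    · rw [Pi.sub_apply]; abel
    · abel

theorem pastState_sub (N : ℕ) (x y : ℝ → Vec n) (ψ φ : ℕ → Vec n) (k : ℕ) :
    pastState N t (x - y) (ψ - φ) k = pastState N t x ψ k - pastState N t y φ k := by
  unfold pastState; split_ifs <;> rfl

variable {wc wc' : ℝ → Vec pc} {wd wd' : ℕ → Vec pd} {ψ φ : ℕ → Vec n} {x z : ℝ → Vec n}

/-- The upper error `z - x` obeys the error dynamics. -/
theorem isErrorTrajectory_sub (hT : ∀ k, t k ≤ t (k + 1)) (hx : IsPlantTrajectory S t wc wd ψ x)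
    (hz : IsObserverTrajectory S Tbar L Ld t (outputC S wc x) (outputD S t wd ψ x) wc' wd' φ z) :
    IsErrorTrajectory S Tbar L Ld t (wc' - wc) (wd' - wd) (φ - ψ) (z - x) := by
  have := hz.sub hT hx
  unfold IsErrorTrajectory
  convert! this using 1
  · funext k r
    simp only [outputC, Matrix.sub_mulVec, Pi.sub_apply, Matrix.mulVec_sub, Matrix.mulVec_add,
      ← Matrix.mulVec_mulVec]
    abel
  · funext k
    simp only [outputD, Matrix.sub_mulVec, Pi.sub_apply, Matrix.mulVec_sub, Matrix.mulVec_add,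
      ← Matrix.mulVec_mulVec, pastState_sub]
    abel

/-- The lower error `x - z` obeys the error dynamics. -/
theorem isErrorTrajectory_sub' (hT : ∀ k, t k ≤ t (k + 1)) (hx : IsPlantTrajectory S t wc wd ψ x)
    (hz : IsObserverTrajectory S Tbar L Ld t (outputC S wc x) (outputD S t wd ψ x) wc' wd' φ z) :
    IsErrorTrajectory S Tbar L Ld t (wc - wc') (wd - wd') (ψ - φ) (x - z) := by
  have := IsTrajectory.sub hT hx hz
  unfold IsErrorTrajectory
  convert! this using 1
  · funext k r
    simp only [outputC, Matrix.sub_mulVec, Pi.sub_apply, Matrix.mulVec_sub, Matrix.mulVec_add,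
      ← Matrix.mulVec_mulVec]
    abel
  · funext k
    simp only [outputD, Matrix.sub_mulVec, Pi.sub_apply, Matrix.mulVec_sub, Matrix.mulVec_add,
      ← Matrix.mulVec_mulVec, pastState_sub]
    abel

end errors

end IntervalObs

/-! ### The observer design theorem. -/

open IntervalObs

theorem mainTheorem10 {n pc pd rc rd : ℕ} (S : IntervalObs.System n pc pd rc rd)
    (Mc Md : Matrix (Fin n) (Fin n) ℝ)
    (hMc : IntervalObs.Nonneg Mc) (hMd : IntervalObs.Nonneg Md)
    (Tbar : ℝ) (hTbar : 0 < Tbar)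
    (X dX : ℝ → Matrix (Fin n) (Fin n) ℝ)
    (hXdiag : ∀ τ ∈ Set.Icc 0 Tbar, (X τ).IsDiag)
    (hXderiv : ∀ τ ∈ Set.Icc 0 Tbar, ∀ i j,
      HasDerivWithinAt (fun s => X s i j) (dX τ i j) (Set.Icc 0 Tbar) τ)
    (hX0 : (X 0).PosDef)
    (hXinv : ∀ τ ∈ Set.Icc 0 Tbar, IsUnit (X τ))
    (Yc : ℝ → Matrix (Fin n) (Fin rc) ℝ) (Yd : Matrix (Fin n) (Fin rd) ℝ)
    (Uc : Matrix (Fin n) (Fin n) ℝ) (hUdiag : Uc.IsDiag) (hUpos : Uc.PosDef)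
    (ε α γ : ℝ) (hε : 0 < ε) (hα : 0 < α) (hγ : 0 < γ)
    (hA : ∀ τ ∈ Set.Icc 0 Tbar, IntervalObs.Nonneg
      (X τ * S.A - Yc τ * S.Cyc + α • (1 : Matrix (Fin n) (Fin n) ℝ)))
    (hGc : ∀ τ ∈ Set.Icc 0 Tbar, IntervalObs.Nonneg (X τ * S.Gc - Yc τ * S.Hyc))
    (hEc : ∀ τ ∈ Set.Icc 0 Tbar, IntervalObs.Nonneg (X τ * S.Ec - Yc τ * S.Fyc))
    (hJ : IntervalObs.Nonneg (X 0 * S.J - Yd * S.Cyd))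
    (hGd : IntervalObs.Nonneg (X 0 * S.Gd - Yd * S.Hyd))
    (hEd : IntervalObs.Nonneg (X 0 * S.Ed - Yd * S.Fyd))
    (hT1 : 1 ᵥ* (X Tbar * S.A - Yc Tbar * S.Cyc + Uc) + 1 ᵥ* Mc ≤ 0)
    (hT2 : 1 ᵥ* (X Tbar * S.Gc - Yc Tbar * S.Hyc - Uc) ≤ 0)
    (hT3 : 1 ᵥ* (X Tbar * S.Ec - Yc Tbar * S.Fyc) - γ • 1 ≤ 0)
    (hC1 : ∀ τ ∈ Set.Icc 0 Tbar,
      1 ᵥ* (dX τ + X τ * S.A - Yc τ * S.Cyc + Uc) + 1 ᵥ* Mc ≤ 0)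
    (hC2 : ∀ τ ∈ Set.Icc 0 Tbar, 1 ᵥ* (X τ * S.Gc - Yc τ * S.Hyc - Uc) ≤ 0)
    (hC3 : ∀ τ ∈ Set.Icc 0 Tbar, 1 ᵥ* (X τ * S.Ec - Yc τ * S.Fyc) - γ • 1 ≤ 0)
    (hD1 : 1 ᵥ* (X 0 * (S.J + S.Gd) - Yd * (S.Cyd + S.Hyd) - X Tbar
      + ε • (1 : Matrix (Fin n) (Fin n) ℝ)) + 1 ᵥ* Md ≤ 0)
    (hD2 : 1 ᵥ* (X 0 * S.Ed - Yd * S.Fyd) - γ • 1 ≤ 0) :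
    IntervalObs.SolvesMinDwell S Mc Md Tbar γ (fun τ => (X τ)⁻¹ * Yc τ) ((X 0)⁻¹ * Yd) := by
  have hm0 : (0 : ℝ) ∈ Icc 0 Tbar := left_mem_Icc.2 hTbar.le
  -- Invertibility keeps the diagonal entries away from zero, so by continuity they keep the
  -- positive sign they have at `0`.
  have hXpos : ∀ τ ∈ Icc 0 Tbar, ∀ i, 0 < X τ i i := fun τ hτ i =>
    pos_of_ne_zero (f := fun τ => X τ i i)
      (fun s hs => (hXderiv s hs i i).continuousWithinAt) (hX0.diag_pos)
      (fun s hs => IsDiag_ne_zero (hXdiag s hs) (hXinv s hs) i) hτ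
  obtain ⟨C, rfl, rfl, hCm, hCr, hC⟩ := exists_certificate S Mc Md hMc hMd Tbar hTbar X dX hXdiag
    hXderiv hXinv hXpos Yc Yd Uc hUdiag (fun i => hUpos.diag_pos.le) ε α γ hε hα hγ hA hGc hEc hJ hGd
    hEd hT1 hC1 hC2 hC3 hD1 hD2
  have hB : ∀ τ ∈ Icc 0 C.T, ∀ {k : ℕ} (A : Matrix (Fin n) (Fin k) ℝ)
      (P : Matrix (Fin rc) (Fin k) ℝ) i j, 0 ≤ (X τ * A - Yc τ * P) i j →
      0 ≤ (A - (X τ)⁻¹ * Yc τ * P) i j := fun τ hτ _ A P i j h =>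
    (mul_nonneg_iff_of_pos_left (hXpos τ hτ i)).1 (by
      rwa [diag_mul_sub_inv_mul_apply (hXdiag τ hτ) (hXinv τ hτ)])
  have hB0 : ∀ {k : ℕ} (A : Matrix (Fin n) (Fin k) ℝ)
      (P : Matrix (Fin rd) (Fin k) ℝ) i j, 0 ≤ (X 0 * A - Yd * P) i j →
      0 ≤ (A - (X 0)⁻¹ * Yd * P) i j := fun A P i j h =>
    (mul_nonneg_iff_of_pos_left (hXpos 0 hm0 i)).1 (by
      rwa [diag_mul_sub_inv_mul_apply (hXdiag 0 hm0) (hXinv 0 hm0)])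
  have hh := S.hc_pos
  have hc := C.initConst_pos hh
  refine ⟨?_, fun τ hτ i j hij => hB τ hτ _ _ i j ?_, fun τ hτ i j => hB τ hτ _ _ i j (hGc τ hτ i j),
    fun τ hτ i j => hB τ hτ _ _ i j (hEc τ hτ i j), fun i j => hB0 _ _ i j (hJ i j),
    fun i j => hB0 _ _ i j (hGd i j), fun i j => hB0 _ _ i j (hEd i j), ⟨?_, ?_⟩, ?_⟩
  · intro t ht wcl wc wcu wdl wd wdu ψl ψ ψu zl x zu hwc hwd hψ hinit hx hzl hzu s hs
    have hT : ∀ k, t k ≤ t (k + 1) := fun k => (ht.lt_succ C.T_pos k).le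
    have hu := hC _ _ _ _ _ _ _ rfl rfl (isErrorTrajectory_sub hT hx hzu)
    have hl := hC _ _ _ _ _ _ _ rfl rfl (isErrorTrajectory_sub' hT hx hzl)
    exact ⟨sub_nonneg.1 (hl.nonneg hh ht (fun s hs => sub_nonneg.2 (hwc s hs).1)
        (fun k => sub_nonneg.2 (hwd k).1) (fun j => sub_nonneg.2 (hψ j).1)
        (fun s hs => sub_nonneg.2 (hinit s hs).1) hs),
      sub_nonneg.1 (hu.nonneg hh ht (fun s hs => sub_nonneg.2 (hwc s hs).2)
        (fun k => sub_nonneg.2 (hwd k).2) (fun j => sub_nonneg.2 (hψ j).2)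
        (fun s hs => sub_nonneg.2 (hinit s hs).2) hs)⟩
  · simpa [Matrix.one_apply_ne hij] using hA τ hτ i j
  · intro η hη
    have hc1 : 0 < 1 + C.κ⁻¹ * C.initConst S.hc := by
      have := C.κ_pos
      positivity
    refine ⟨η / (1 + C.κ⁻¹ * C.initConst S.hc), by positivity, fun t ht ψ e he hsize s hs => ?_⟩
    refine ((hC _ _ _ _ _ _ _ rfl rfl he).oneNorm_le hh ht hs).trans_lt ?_
    rwa [lt_div_iff₀' hc1] at hsize
  · intro t ht ψ e he
    exact (hC _ _ _ _ _ _ _ rfl rfl he).tendsto_zero hh ht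
  -- A linear `v` suffices, since the initial contribution to the balance is at most linear in the
  -- initial size; its slope is positive by the added `1` in `initConst`.
  · refine ⟨fun s => C.initConst S.hc * s, fun a _ b _ hab => mul_lt_mul_of_pos_left hab hc,
      mul_zero _, tendsto_id.const_mul_atTop hc, fun t ht δc δd hδc _ ψ e he => ?_⟩
    refine le_trans (add_le_add ?_ ?_) ((hC _ _ _ _ _ _ _ rfl rfl he).gain_le hh ht hδc)
    · exact normL1_mono fun s => by rw [hCm]; exact oneNorm_mulVec_le hMc _
    · refine ENNReal.tsum_le_tsum fun k => ENNReal.ofReal_le_ofReal ?_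
      rw [hCr]; exact oneNorm_mulVec_le hMd _
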